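/- For $A\subseteq\mathbb R^2$ let $A^c=\bigcap_{x\in A}B(x,1)$ be its $c$-dual, where $B(x,r)$ is the closed Euclidean disc of radius $r$ about $x$ (and $\emptyset^c=\mathbb R^2$), and let $\mathcal S_2=\{A^c : A\subseteq\mathbb R^2\}$ be the class of all intersections of closed unit discs. For every $K\in\mathcal S_2\setminus\{\emptyset,\mathbb R^2\}$, $$\sqrt{2\pi-4}\ \le\ \mathrm{Area}(K)^{1/2}+\mathrm{Area}(K^c)^{1/2}\ \le\ \sqrt{\pi}.$$ Equality on the left holds for the self-dual lens, and equality on the right holds for every disc of radius $\tfrac12$. Here a lens is a non-empty intersection $B(p,1)\cap B(q,1)$ of two closed unit discs, and it is self-dual if it is congruent to its $c$-dual. Self-dual lenses exist, and for a lens, being self-dual is equivalent to having diameter $\sqrt2$, and also equivalent to having angle $\pi/2$, where the angle of a lens is the central angle of each of its two bounding unit circle arcs (so that its perimeter is twice its angle). Both the self-dual lenses and the discs of radius $\tfrac12$ belong to $\mathcal S_2\setminus\{\emptyset,\mathbb R^2\}$. -/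

import Mathlib

open MeasureTheory Metric

namespace BallBody

/-- The `c`-dual `A^c` of a set `A ⊆ ℝⁿ`: the intersection of all closed Euclidean unit balls
centred at points of `A` (so that `∅^c = ℝⁿ`). -/
def cDual {n : ℕ} (A : Set (EuclideanSpace ℝ (Fin n))) : Set (EuclideanSpace ℝ (Fin n)) :=
  ⋂ x ∈ A, closedBall x 1

/-- The class `S_n` of ball-bodies in `ℝⁿ`: all intersections of closed Euclidean unit balls.
It contains the two degenerate members `∅` and `ℝⁿ`. -/
def ballBodies (n : ℕ) : Set (Set (EuclideanSpace ℝ (Fin n))) :=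
  {K | ∃ A : Set (EuclideanSpace ℝ (Fin n)), K = ⋂ x ∈ A, closedBall x 1}

/-- The area (two-dimensional Lebesgue measure) of a subset of the Euclidean plane; it is only
used for bounded sets. -/
noncomputable def area (K : Set (EuclideanSpace ℝ (Fin 2))) : ℝ :=
  (volume K).toReal

/-- A lens: a non-empty intersection of two closed unit balls. -/
def IsLens {n : ℕ} (L : Set (EuclideanSpace ℝ (Fin n))) : Prop :=
  L.Nonempty ∧ ∃ p q : EuclideanSpace ℝ (Fin n), L = closedBall p 1 ∩ closedBall q 1

/-- `L` is self-dual: a rigid motion of `ℝⁿ` (possibly orientation reversing) maps `L` onto its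
`c`-dual. -/
def IsSelfDual {n : ℕ} (L : Set (EuclideanSpace ℝ (Fin n))) : Prop :=
  ∃ g : EuclideanSpace ℝ (Fin n) ≃ᵢ EuclideanSpace ℝ (Fin n), g '' L = cDual L

/-- The planar lens `L` is bounded by two unit circle arcs of angle `θ`: it is the intersection of
the unit discs about `p` and `q`, its corners `a` and `b` lie on both bounding circles at distance
`diam L`, and they are seen under the angle `θ` from the two centres. (For `p = q` the lens is a
unit disc, `a` and `b` are antipodal, and the angle is `π`.) -/
def HasLensAngle (L : Set (EuclideanSpace ℝ (Fin 2))) (θ : ℝ) : Prop :=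
  ∃ p q a b : EuclideanSpace ℝ (Fin 2), L = closedBall p 1 ∩ closedBall q 1 ∧
    a ∈ sphere p 1 ∩ sphere q 1 ∧ b ∈ sphere p 1 ∩ sphere q 1 ∧ dist a b = diam L ∧
    EuclideanGeometry.angle a p b = θ ∧ EuclideanGeometry.angle a q b = θ

end BallBody

/-! Let `h` be the support function of `K` in terms of the normal angle. The dual has support
function `φ ↦ 1 - h (φ + π)` (`supp_cDual`), so formally the radii of curvature of `K` and its dual
at opposite normals add up to `1`. Both therefore lie in `[0, 1]`, and the half perimeters are `x`
and `π - x`. It suffices to bound an area in terms of the half perimeter.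

Cut the body by a chord joining two boundary points with opposite normals. If an arc on one side has
length `ℓ` and direction `θ(s)` at arc length `s`, the area between arc and chord is a quarter of `∬
sin |θ(t) - θ(s)|`. The curvature bound gives `|t - s| ≤ |θ(t) - θ(s)| ≤ π - ℓ + |t - s|`. By
concavity the sine lies above its chord over this range and below its tangent at `π |t - s| / ℓ`.
Both lines have a slope `β(|t - s|)` with `β(ℓ - u) = -β(u)`, and such a kernel integrates to zero
against `|θ(t) - θ(s)|` (`integral_antisymm_kernel`). So `θ` may be replaced by `t ↦ t` (a lens) in
the lower bound and by `t ↦ π t / ℓ` (a half disc) in the upper one: the double integral lies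
between `2 (ℓ - sin ℓ)` and `2 ℓ² / π`.

Convexity of `ℓ - sin ℓ` gives area at least `x - sin x`; a chord halving the perimeter gives area
at most `x² / π`. The upper bounds `x / √π` and `(π - x) / √π` for the roots add up to `√π`. The
lower ones leave a scalar inequality, with equality at `x = π / 2` (`sqrt_lens_add_sqrt_lens`).

As `h` need not be smooth, the argument is run on circumscribed polygons with normals at the
multiples of `δ = π / 2 ^ (k + 1)`, with errors vanishing as `δ → 0` (`polyArea_dual_bounds`,
`tendsto_polyArea`). The equality cases are computed in coordinates. -/

namespace BallBody

/-! ### Antisymmetric kernels on a square -/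

/-- The odd extension of a kernel `β` on `[0, ∞)`. -/
noncomputable def oddKernel (β : ℝ → ℝ) (x : ℝ) : ℝ := if 0 ≤ x then β x else -β (-x)

lemma oddKernel_mul {β θ : ℝ → ℝ} (hθ : Monotone θ) (s t : ℝ) :
    oddKernel β (t - s) * (θ t - θ s) = β |t - s| * |θ t - θ s| := by
  unfold oddKernel
  split_ifs with h
  · rw [abs_of_nonneg h, abs_of_nonneg (sub_nonneg.2 (hθ (sub_nonneg.1 h)))]
  · push Not at h
    rw [abs_of_neg h, abs_of_nonpos (sub_nonpos.2 (hθ (sub_neg.1 h).le))]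
    ring

lemma oddKernel_neg {β : ℝ → ℝ} {x : ℝ} (hx : x ≠ 0) : oddKernel β (-x) = -oddKernel β x := by
  unfold oddKernel
  rcases lt_or_gt_of_ne hx with h | h
  · rw [if_pos (by linarith), if_neg (by linarith)]; ring
  · rw [if_neg (by linarith), if_pos (by linarith)]; ring_nf

lemma measurable_oddKernel {β : ℝ → ℝ} (hβ : Continuous β) : Measurable (oddKernel β) := by
  unfold oddKernel
  exact Measurable.ite measurableSet_Ici hβ.measurable (hβ.comp continuous_neg).neg.measurable

/-- The value `g t` is left free, being irrelevant to the integral. Even kernels use `ε = 1`, odd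
ones `ε = -1`. -/
lemma integral_kernel {f : ℝ → ℝ} (ε : ℝ) (hf : Continuous f) {ℓ t : ℝ} (g : ℝ → ℝ)
    (hg1 : ∀ s, s < t → g s = f (t - s)) (hg2 : ∀ s, t < s → g s = ε * f (s - t)) (ht : t ∈ Set.Icc 0 ℓ) :
    ∫ s in (0:ℝ)..ℓ, g s = (∫ u in (0:ℝ)..t, f u) + ε * ∫ u in (0:ℝ)..(ℓ - t), f u := by
  have e1 : Set.EqOn (fun s => f (t - s)) g (Set.Ioo 0 t) := fun s hs => (hg1 s hs.2).symm
  have e2 : Set.EqOn (fun s => ε * f (s - t)) g (Set.Ioo t ℓ) := fun s hs => (hg2 s hs.1).symm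
  have c1 : Continuous fun s => f (t - s) := by fun_prop
  have c2 : Continuous fun s => ε * f (s - t) := by fun_prop
  have ae1 : ∀ᵐ s, s ∈ Set.uIoc 0 t → f (t - s) = g s := by
    filter_upwards [compl_mem_ae_iff.2 (measure_singleton (μ := volume) t)] with s hs h
    rw [Set.uIoc_of_le ht.1] at h
    exact e1 ⟨h.1, lt_of_le_of_ne h.2 hs⟩
  have ae2 : ∀ᵐ s, s ∈ Set.uIoc t ℓ → ε * f (s - t) = g s := by
    filter_upwards [compl_mem_ae_iff.2 (measure_singleton (μ := volume) ℓ)] with s hs h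
    rw [Set.uIoc_of_le ht.2] at h
    exact e2 ⟨h.1, lt_of_le_of_ne h.2 hs⟩
  have i1 : IntervalIntegrable g volume 0 t :=
    (c1.intervalIntegrable 0 t).congr_ae ((ae_restrict_iff' measurableSet_uIoc).2 ae1)
  have i2 : IntervalIntegrable g volume t ℓ :=
    (c2.intervalIntegrable t ℓ).congr_ae ((ae_restrict_iff' measurableSet_uIoc).2 ae2)
  rw [← intervalIntegral.integral_add_adjacent_intervals i1 i2,
    ← intervalIntegral.integral_congr_ae ae1, ← intervalIntegral.integral_congr_ae ae2,
    intervalIntegral.integral_const_mul, intervalIntegral.integral_comp_sub_left f,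
    intervalIntegral.integral_comp_sub_right f]
  simp

/-- The integral is that of `β` over `[0, t]` minus that over `[0, ℓ - t]`. Antisymmetry turns the
second into minus the integral over `[t, ℓ]`, and the integral over all of `[0, ℓ]` vanishes. -/
lemma integral_oddKernel {β : ℝ → ℝ} (hβ : Continuous β) {ℓ t : ℝ}
    (hanti : ∀ u, β (ℓ - u) = -β u) (ht : t ∈ Set.Icc 0 ℓ) :
    ∫ s in (0:ℝ)..ℓ, oddKernel β (t - s) = 0 := by
  rw [integral_kernel (-1) hβ (fun s => oddKernel β (t - s)) (t := t) _ _ ht]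
  · have h1 : ∫ u in (0:ℝ)..(ℓ - t), β u = -∫ u in t..ℓ, β u := by
      rw [← intervalIntegral.integral_neg]
      have := intervalIntegral.integral_comp_sub_left β ℓ (a := t) (b := ℓ)
      simp only [hanti, sub_self] at this
      exact this.symm
    have h2 : ∫ u in (0:ℝ)..ℓ, β u = 0 := by
      have := intervalIntegral.integral_comp_sub_left β ℓ (a := 0) (b := ℓ)
      simp only [hanti, sub_self, sub_zero, intervalIntegral.integral_neg] at this
      linarith
    have h3 := intervalIntegral.integral_add_adjacent_intervals
      (hβ.intervalIntegrable (μ := volume) 0 t) (hβ.intervalIntegrable (μ := volume) t ℓ)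
    rw [h1]; linarith
  · intro s hs; simp [oddKernel, hs.le]
  · intro s hs; simp [oddKernel, hs]

/-- Lebesgue measure on the square `(0, ℓ]²`. -/
noncomputable def squareMeasure (ℓ : ℝ) : Measure (ℝ × ℝ) :=
  (volume.restrict (Set.Ioc 0 ℓ)).prod (volume.restrict (Set.Ioc 0 ℓ))

instance (ℓ : ℝ) : IsFiniteMeasure (squareMeasure ℓ) := by
  unfold squareMeasure; infer_instance

lemma squareMeasure_eq (ℓ : ℝ) :
    squareMeasure ℓ = volume.restrict (Set.Ioc 0 ℓ ×ˢ Set.Ioc 0 ℓ) := by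
  rw [squareMeasure, Measure.prod_restrict]; rfl

lemma integrable_square {ℓ : ℝ} {F : ℝ × ℝ → ℝ} (hF : Measurable F) {C : ℝ}
    (hC : ∀ s ∈ Set.Ioc 0 ℓ, ∀ t ∈ Set.Ioc 0 ℓ, |F (s, t)| ≤ C) : Integrable F (squareMeasure ℓ) := by
  refine Integrable.of_bound hF.aestronglyMeasurable C ?_
  rw [squareMeasure_eq]
  refine (ae_restrict_iff' (measurableSet_Ioc.prod measurableSet_Ioc)).2 (Filter.Eventually.of_forall ?_)
  rintro ⟨s, t⟩ h
  exact hC s h.1 t h.2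

lemma integral_square {ℓ : ℝ} (hℓ : 0 ≤ ℓ) {F : ℝ × ℝ → ℝ} (hF : Integrable F (squareMeasure ℓ)) :
    ∫ z, F z ∂squareMeasure ℓ = ∫ t in (0:ℝ)..ℓ, ∫ s in (0:ℝ)..ℓ, F (s, t) := by
  rw [squareMeasure] at *
  rw [integral_prod_symm _ hF]
  simp_rw [intervalIntegral.integral_of_le hℓ]

lemma exists_bound_Icc {f : ℝ → ℝ} (hf : Continuous f) (a b : ℝ) :
    ∃ C, ∀ x ∈ Set.Icc a b, |f x| ≤ C :=
  isCompact_Icc.exists_bound_of_continuousOn hf.continuousOn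

lemma abs_oddKernel_le {β : ℝ → ℝ} {ℓ C : ℝ} (hC : ∀ x ∈ Set.Icc 0 ℓ, |β x| ≤ C) {x : ℝ}
    (hx : |x| ≤ ℓ) : |oddKernel β x| ≤ C := by
  rw [abs_le] at hx
  unfold oddKernel
  split_ifs with h
  · exact hC x ⟨h, hx.2⟩
  · rw [abs_neg]; exact hC (-x) ⟨by linarith, by linarith⟩

lemma abs_monotone_le {θ : ℝ → ℝ} (hθ : Monotone θ) {ℓ x : ℝ} (hx : x ∈ Set.Ioc 0 ℓ) :
    |θ x| ≤ |θ 0| + |θ ℓ| := by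
  have h1 := hθ hx.1.le
  have h2 := hθ hx.2
  rw [abs_le]
  constructor <;> cases abs_cases (θ 0) <;> cases abs_cases (θ ℓ) <;> linarith

lemma abs_sub_le_of_mem {ℓ s t : ℝ} (hs : s ∈ Set.Ioc 0 ℓ) (ht : t ∈ Set.Ioc 0 ℓ) : |t - s| ≤ ℓ := by
  rw [abs_le]; constructor <;> linarith [hs.1, hs.2, ht.1, ht.2]

lemma measurable_mul_abs {β θ : ℝ → ℝ} (hβ : Continuous β) (hθ : Monotone θ) :
    Measurable fun z : ℝ × ℝ => β |z.2 - z.1| * |θ z.2 - θ z.1| := by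
  have h1 := hβ.measurable
  have h2 := hθ.measurable
  exact (h1.comp (by fun_prop)).mul (((h2.comp measurable_snd).sub (h2.comp measurable_fst)).abs)

lemma integrable_mul_abs {β θ : ℝ → ℝ} (hβ : Continuous β) (hθ : Monotone θ) (ℓ : ℝ) :
    Integrable (fun z : ℝ × ℝ => β |z.2 - z.1| * |θ z.2 - θ z.1|) (squareMeasure ℓ) := by
  obtain ⟨C, hC⟩ := exists_bound_Icc hβ 0 ℓ
  refine integrable_square (measurable_mul_abs hβ hθ) (C := C * (2 * (|θ 0| + |θ ℓ|))) ?_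
  intro s hs t ht
  rw [abs_mul, abs_abs]
  have h1 := hC _ ⟨abs_nonneg _, abs_sub_le_of_mem hs ht⟩
  have h2 := abs_sub (θ t) (θ s)
  have h3 := abs_monotone_le hθ hs
  have h4 := abs_monotone_le hθ ht
  exact mul_le_mul h1 (by linarith) (abs_nonneg _) ((abs_nonneg _).trans h1)

/-- An antisymmetric kernel integrates to zero against the increments of a monotone function. -/
theorem integral_antisymm_kernel {β θ : ℝ → ℝ} (hβ : Continuous β) (hθ : Monotone θ) {ℓ : ℝ}
    (hℓ : 0 ≤ ℓ) (hanti : ∀ u, β (ℓ - u) = -β u) :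
    ∫ z, β |z.2 - z.1| * |θ z.2 - θ z.1| ∂squareMeasure ℓ = 0 := by
  obtain ⟨C, hC⟩ := exists_bound_Icc hβ 0 ℓ
  have mB := measurable_oddKernel hβ
  have mθ := hθ.measurable
  have int2 : Integrable (fun z : ℝ × ℝ => oddKernel β (z.2 - z.1) * θ z.2) (squareMeasure ℓ) := by
    refine integrable_square ((mB.comp (by fun_prop)).mul (mθ.comp measurable_snd))
      (C := C * (|θ 0| + |θ ℓ|)) ?_
    intro s hs t ht
    rw [abs_mul]
    have h1 := abs_oddKernel_le hC (abs_sub_le_of_mem hs ht)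
    exact mul_le_mul h1 (abs_monotone_le hθ ht) (abs_nonneg _) ((abs_nonneg _).trans h1)
  have int1 : Integrable (fun z : ℝ × ℝ => oddKernel β (z.2 - z.1) * θ z.1) (squareMeasure ℓ) := by
    refine integrable_square ((mB.comp (by fun_prop)).mul (mθ.comp measurable_fst))
      (C := C * (|θ 0| + |θ ℓ|)) ?_
    intro s hs t ht
    rw [abs_mul]
    have h1 := abs_oddKernel_le hC (abs_sub_le_of_mem hs ht)
    exact mul_le_mul h1 (abs_monotone_le hθ hs) (abs_nonneg _) ((abs_nonneg _).trans h1)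
  -- For fixed `t` the factor `θ t` is constant and the kernel integrates to zero in `s`.
  have e2 : ∫ z, oddKernel β (z.2 - z.1) * θ z.2 ∂squareMeasure ℓ = 0 := by
    rw [integral_square hℓ int2]
    have : Set.EqOn (fun t => ∫ s in (0:ℝ)..ℓ, oddKernel β (t - s) * θ t) (fun _ => (0:ℝ))
        (Set.uIcc 0 ℓ) := by
      intro t ht
      rw [Set.uIcc_of_le hℓ] at ht
      simp only [intervalIntegral.integral_mul_const, integral_oddKernel hβ hanti ht, zero_mul]
    rw [intervalIntegral.integral_congr this]; simp
  have e1 : ∫ z, oddKernel β (z.2 - z.1) * θ z.1 ∂squareMeasure ℓ =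
      -∫ z, oddKernel β (z.2 - z.1) * θ z.2 ∂squareMeasure ℓ := by
    rw [← integral_neg]
    unfold squareMeasure
    rw [← integral_prod_swap (fun z : ℝ × ℝ => oddKernel β (z.2 - z.1) * θ z.1)]
    rw [← squareMeasure]
    refine integral_congr_ae ?_
    -- At `0` the odd extension takes the value `β 0`, so oddness may fail on the diagonal, a null
    -- set.
    have hdiag : ∀ᵐ z ∂squareMeasure ℓ, z.2 ≠ z.1 := by
      rw [squareMeasure, Measure.ae_prod_iff_ae_ae]
      · refine Filter.Eventually.of_forall fun x => ?_
        exact compl_mem_ae_iff.2 (measure_singleton x)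
      · exact (measurableSet_eq_fun measurable_snd measurable_fst).compl
    filter_upwards [hdiag] with z hz
    have := oddKernel_neg (β := β) (sub_ne_zero.2 hz)
    rw [neg_sub] at this
    simp only [Prod.swap, this]
    ring
  calc ∫ z, β |z.2 - z.1| * |θ z.2 - θ z.1| ∂squareMeasure ℓ
      = ∫ z, (oddKernel β (z.2 - z.1) * θ z.2 - oddKernel β (z.2 - z.1) * θ z.1) ∂squareMeasure ℓ := by
        congr 1; ext z; rw [← mul_sub, oddKernel_mul hθ]
    _ = 0 := by rw [integral_sub int2 int1, e1, e2]; simp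

/-- The value for the extremal directions `θ(t) = c t`: a lens for `c = 1`, a half disc for `c = π /
ℓ`. -/
lemma integral_sin_abs_sub {c ℓ : ℝ} (hc : c ≠ 0) (hℓ : 0 ≤ ℓ) :
    ∫ z, Real.sin (c * |z.2 - z.1|) ∂squareMeasure ℓ = 2 * (ℓ / c - Real.sin (c * ℓ) / c ^ 2) := by
  have hi : Integrable (fun z : ℝ × ℝ => Real.sin (c * |z.2 - z.1|)) (squareMeasure ℓ) :=
    integrable_square (by fun_prop) (C := 1) fun s _ t _ => Real.abs_sin_le_one _
  rw [integral_square hℓ hi]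
  have hs : ∀ a : ℝ, ∫ u in (0:ℝ)..a, Real.sin (c * u) = (1 - Real.cos (c * a)) / c := by
    intro a
    rw [intervalIntegral.integral_comp_mul_left Real.sin hc, integral_sin]
    simp; ring
  have h1 : Set.EqOn (fun t => ∫ s in (0:ℝ)..ℓ, Real.sin (c * |t - s|))
      (fun t => (1 - Real.cos (c * t)) / c + (1 - Real.cos (c * (ℓ - t))) / c) (Set.uIcc 0 ℓ) := by
    intro t ht
    rw [Set.uIcc_of_le hℓ] at ht
    simp only
    rw [integral_kernel 1 (f := fun u => Real.sin (c * u)) (by fun_prop) _ _ _ ht, hs, hs]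
    · ring
    · intro s h; rw [abs_of_pos (by linarith)]
    · intro s h; rw [abs_of_neg (by linarith)]; ring_nf
  rw [intervalIntegral.integral_congr h1, intervalIntegral.integral_add
    (Continuous.intervalIntegrable (by fun_prop) _ _) (Continuous.intervalIntegrable (by fun_prop) _ _),
    intervalIntegral.integral_comp_sub_left (fun t => (1 - Real.cos (c * t)) / c)]
  have h2 : ∫ t in (0:ℝ)..ℓ, (1 - Real.cos (c * t)) / c = ℓ / c - Real.sin (c * ℓ) / c ^ 2 := by
    rw [intervalIntegral.integral_div, intervalIntegral.integral_sub
      (Continuous.intervalIntegrable (by fun_prop) _ _) (Continuous.intervalIntegrable (by fun_prop) _ _),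
      intervalIntegral.integral_comp_mul_left Real.cos hc, integral_cos]
    simp
    field_simp
  simp only [sub_self, sub_zero, h2]
  ring

/-! ### Concavity of the sine and the two bounds for the double integral -/

/-- Concavity puts the sine above its chord over `[u, π - ℓ + u]`, with end values `sin u` and `sin
(ℓ - u)`. For polygons `D` may leave this interval by `ε`; moving it back costs at most `ε` in the
sine and `ε` on the chord, whose slope is at most `1` in absolute value. For `ℓ = π` the interval is
a point and the quotient is `0` by convention. -/
lemma sin_ge_chord {ℓ u D ε : ℝ} (hℓ : ℓ ≤ Real.pi) (hu : u ∈ Set.Icc 0 ℓ) (hε : 0 ≤ ε)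
    (h1 : u - ε ≤ D) (h2 : D ≤ Real.pi - ℓ + u + ε) :
    Real.sin u + (Real.sin (ℓ - u) - Real.sin u) / (Real.pi - ℓ) * (D - u) - 2 * ε ≤ Real.sin D := by
  obtain ⟨hu0, hu1⟩ := hu
  set β := (Real.sin (ℓ - u) - Real.sin u) / (Real.pi - ℓ) with hβ
  set D' := max u (min D (Real.pi - ℓ + u)) with hD'
  have hD'1 : u ≤ D' := le_max_left _ _
  have hD'2 : D' ≤ Real.pi - ℓ + u := max_le (by linarith) (min_le_right _ _)
  have hDD : |D' - D| ≤ ε := by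
    rw [abs_le]
    constructor
    · have : min D (Real.pi - ℓ + u) ≤ D' := le_max_right _ _
      rcases min_cases D (Real.pi - ℓ + u) with h | h <;> linarith
    · have : D' ≤ D + ε := max_le (by linarith) ((min_le_left _ _).trans (by linarith))
      linarith
  have hsinb : Real.sin (ℓ - u) = Real.sin (Real.pi - ℓ + u) := by
    rw [← Real.sin_pi_sub]; ring_nf
  have hβ1 : |β| ≤ 1 := by
    rcases hℓ.eq_or_lt with h | h
    · rw [hβ, h]; simp
    · rw [hβ, abs_div, abs_of_pos (sub_pos.2 h), div_le_one (sub_pos.2 h), hsinb]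
      have := Real.abs_sin_sub_sin_le (Real.pi - ℓ + u) u
      rwa [show Real.pi - ℓ + u - u = Real.pi - ℓ by ring, abs_of_pos (sub_pos.2 h)] at this
  have hchord : Real.sin u + β * (D' - u) ≤ Real.sin D' := by
    rcases hℓ.eq_or_lt with h | h
    · have : D' = u := le_antisymm (by linarith) hD'1
      simp [this]
    · have hpos := sub_pos.2 h
      set w := (D' - u) / (Real.pi - ℓ) with hw
      have hw0 : 0 ≤ w := div_nonneg (by linarith) hpos.le
      have hw1 : w ≤ 1 := by rw [hw, div_le_one hpos]; linarith
      have hwm : w * (Real.pi - ℓ) = D' - u := by rw [hw]; field_simp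
      have key := strictConcaveOn_sin_Icc.concaveOn.2 (x := u) (y := Real.pi - ℓ + u)
        ⟨hu0, by linarith⟩ ⟨by linarith, by linarith⟩ (sub_nonneg.2 hw1) hw0 (by ring)
      simp only [smul_eq_mul] at key
      rw [show (1 - w) * u + w * (Real.pi - ℓ + u) = D' by linear_combination hwm, ← hsinb] at key
      have : β * (D' - u) = w * (Real.sin (ℓ - u) - Real.sin u) := by
        rw [hβ, hw]; ring
      linarith
  have hlip := (Real.abs_sin_sub_sin_le D' D).trans hDD
  have hβD : |β * (D' - D)| ≤ ε := by
    rw [abs_mul]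
    calc |β| * |D' - D| ≤ 1 * ε := mul_le_mul hβ1 hDD (abs_nonneg _) zero_le_one
      _ = ε := one_mul _
  have e1 := (abs_le.1 hlip).2
  have e2 := (abs_le.1 hβD).1
  have : β * (D' - D) = β * (D' - u) - β * (D - u) := by ring
  linarith

lemma sin_le_tangent {a D : ℝ} (ha : a ∈ Set.Icc 0 Real.pi) (hD : D ∈ Set.Icc 0 Real.pi) :
    Real.sin D ≤ Real.sin a + Real.cos a * (D - a) := by
  have concave := strictConcaveOn_sin_Icc.concaveOn
  rcases lt_trichotomy D a with h | h | h
  · have := concave.le_slope_of_hasDerivAt hD ha h (Real.hasDerivAt_sin a)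
    rw [slope_def_field, le_div_iff₀ (by linarith)] at this
    linarith
  · simp [h]
  · have := concave.slope_le_of_hasDerivAt ha hD h (Real.hasDerivAt_sin a)
    rw [slope_def_field, div_le_iff₀ (by linarith)] at this
    linarith

lemma integrable_sin_mul_abs_sub {θ : ℝ → ℝ} (hθ : Measurable θ) (c ℓ : ℝ) :
    Integrable (fun z : ℝ × ℝ => Real.sin (c * |θ z.2 - θ z.1|)) (squareMeasure ℓ) :=
  integrable_square (Real.measurable_sin.comp
    ((((hθ.comp measurable_snd).sub (hθ.comp measurable_fst)).abs).const_mul c))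
    (C := 1) fun _ _ _ _ => Real.abs_sin_le_one _

lemma integral_square_mono {ℓ : ℝ} {F G : ℝ × ℝ → ℝ} (hF : Integrable F (squareMeasure ℓ))
    (hG : Integrable G (squareMeasure ℓ))
    (h : ∀ s ∈ Set.Ioc 0 ℓ, ∀ t ∈ Set.Ioc 0 ℓ, F (s, t) ≤ G (s, t)) :
    ∫ z, F z ∂squareMeasure ℓ ≤ ∫ z, G z ∂squareMeasure ℓ := by
  refine integral_mono_ae hF hG ?_
  rw [squareMeasure_eq]
  refine (ae_restrict_iff' (measurableSet_Ioc.prod measurableSet_Ioc)).2 (Filter.Eventually.of_forall ?_)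
  rintro ⟨s, t⟩ hst
  exact h s hst.1 t hst.2

lemma squareMeasure_real_univ {ℓ : ℝ} (hℓ : 0 ≤ ℓ) : (squareMeasure ℓ).real Set.univ = ℓ ^ 2 := by
  rw [squareMeasure_eq, measureReal_restrict_apply_univ, Measure.volume_eq_prod, measureReal_prod_prod]
  simp [hℓ, sq]

/-- The chord slope is antisymmetric about `ℓ / 2`, so it integrates to zero both against `|θ t - θ
s|` and against `|t - s|`; only the integral of `sin |t - s|` and the error remain. -/
theorem integral_sin_ge {θ : ℝ → ℝ} (hθ : Monotone θ) {ℓ ε : ℝ} (h0 : 0 ≤ ℓ) (hℓ : ℓ ≤ Real.pi)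
    (hε : 0 ≤ ε)
    (h1 : ∀ s ∈ Set.Ioc 0 ℓ, ∀ t ∈ Set.Ioc 0 ℓ, |t - s| - ε ≤ |θ t - θ s|)
    (h2 : ∀ s ∈ Set.Ioc 0 ℓ, ∀ t ∈ Set.Ioc 0 ℓ, |θ t - θ s| ≤ Real.pi - ℓ + |t - s| + ε) :
    2 * (ℓ - Real.sin ℓ) - 2 * ε * ℓ ^ 2 ≤ ∫ z, Real.sin |θ z.2 - θ z.1| ∂squareMeasure ℓ := by
  set β : ℝ → ℝ := fun u => (Real.sin (ℓ - u) - Real.sin u) / (Real.pi - ℓ) with hβ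
  have cβ : Continuous β := by fun_prop
  have anti : ∀ u, β (ℓ - u) = -β u := by
    intro u; simp only [hβ]; rw [sub_sub_cancel]; ring
  have iθ := integral_antisymm_kernel cβ hθ h0 anti
  have iid := integral_antisymm_kernel cβ monotone_id h0 anti
  have is := integral_sin_abs_sub (one_ne_zero) h0
  have n1 := integrable_mul_abs cβ hθ ℓ
  have n2 := integrable_mul_abs cβ monotone_id ℓ
  have n3 := integrable_sin_mul_abs_sub measurable_id 1 ℓ
  have n4 := integrable_sin_mul_abs_sub hθ.measurable 1 ℓ
  simp only [id, one_mul] at iid is n2 n3 n4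
  have n12 : Integrable (fun z : ℝ × ℝ => β |z.2 - z.1| * |θ z.2 - θ z.1| -
      β |z.2 - z.1| * |z.2 - z.1|) (squareMeasure ℓ) := n1.sub n2
  have n123 : Integrable (fun z : ℝ × ℝ => Real.sin |z.2 - z.1| + (β |z.2 - z.1| * |θ z.2 - θ z.1| -
      β |z.2 - z.1| * |z.2 - z.1|)) (squareMeasure ℓ) := n3.add n12
  have n5 : Integrable (fun _ : ℝ × ℝ => 2 * ε) (squareMeasure ℓ) := integrable_const _
  have key := integral_square_mono (ℓ := ℓ) (F := fun z : ℝ × ℝ => (Real.sin |z.2 - z.1| +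
      (β |z.2 - z.1| * |θ z.2 - θ z.1| - β |z.2 - z.1| * |z.2 - z.1|)) - 2 * ε)
      (G := fun z => Real.sin |θ z.2 - θ z.1|) (n123.sub n5) n4 ?_
  · rw [integral_sub n123 n5, integral_add n3 n12, integral_sub n1 n2, iθ, iid, is, integral_const,
      squareMeasure_real_univ h0, smul_eq_mul] at key
    linarith
  · intro s hs t ht
    have := sin_ge_chord hℓ ⟨abs_nonneg _, abs_sub_le_of_mem hs ht⟩ hε (h1 s hs t ht) (h2 s hs t ht)
    simp only [hβ]
    linarith

/-- With `c = π / ℓ`, the tangent to the sine at `c u` has slope `cos (c u)`, antisymmetric about `ℓ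
/ 2`. The same cancellation compares `θ` with `t ↦ c t`. -/
theorem integral_sin_le {θ : ℝ → ℝ} (hθ : Monotone θ) {ℓ : ℝ} (h0 : 0 ≤ ℓ)
    (h : ∀ s ∈ Set.Ioc 0 ℓ, ∀ t ∈ Set.Ioc 0 ℓ, |θ t - θ s| ≤ Real.pi) :
    ∫ z, Real.sin |θ z.2 - θ z.1| ∂squareMeasure ℓ ≤ 2 * (ℓ ^ 2 / Real.pi) := by
  rcases h0.eq_or_lt with rfl | h0'
  · simp [squareMeasure]
  have hpi := Real.pi_pos
  set c := Real.pi / ℓ with hc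
  have hc0 : 0 < c := by positivity
  have hcℓ : c * ℓ = Real.pi := by rw [hc]; field_simp
  set β : ℝ → ℝ := fun u => Real.cos (c * u) with hβ
  have cβ : Continuous β := by fun_prop
  have anti : ∀ u, β (ℓ - u) = -β u := by
    intro u; simp only [hβ]; rw [mul_sub, hcℓ, Real.cos_pi_sub]
  have iθ := integral_antisymm_kernel cβ hθ h0 anti
  have mono_c : Monotone fun x : ℝ => c * x := fun x y hxy => mul_le_mul_of_nonneg_left hxy hc0.le
  have iid := integral_antisymm_kernel cβ mono_c h0 anti
  have is := integral_sin_abs_sub hc0.ne' h0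
  have n1 := integrable_mul_abs cβ hθ ℓ
  have n2 := integrable_mul_abs cβ mono_c ℓ
  have n3 := integrable_sin_mul_abs_sub measurable_id c ℓ
  have n4 := integrable_sin_mul_abs_sub hθ.measurable 1 ℓ
  simp only [id, one_mul] at n3 n4
  have n12 : Integrable (fun z : ℝ × ℝ => β |z.2 - z.1| * |θ z.2 - θ z.1| -
      β |z.2 - z.1| * |c * z.2 - c * z.1|) (squareMeasure ℓ) := n1.sub n2
  have key := integral_square_mono (ℓ := ℓ) (G := fun z : ℝ × ℝ => (Real.sin (c * |z.2 - z.1|) +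
      (β |z.2 - z.1| * |θ z.2 - θ z.1| - β |z.2 - z.1| * |c * z.2 - c * z.1|)))
      (F := fun z => Real.sin |θ z.2 - θ z.1|) n4 (n3.add n12) ?_
  · rw [integral_add n3 n12, integral_sub n1 n2, iθ, iid, is, hcℓ, Real.sin_pi] at key
    refine key.trans (le_of_eq ?_)
    rw [hc]; field_simp; simp
  · intro s hs t ht
    have hu := abs_sub_le_of_mem hs ht
    have hcu : c * |t - s| ≤ Real.pi := by
      rw [← hcℓ]; exact mul_le_mul_of_nonneg_left hu hc0.le
    have := sin_le_tangent (a := c * |t - s|) ⟨by positivity, hcu⟩ ⟨abs_nonneg _, h s hs t ht⟩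
    have e : |c * t - c * s| = c * |t - s| := by rw [← mul_sub, abs_mul, abs_of_pos hc0]
    simp only [hβ, e]
    linarith

/-! ### Polygonal chains as step functions of arc length -/

/-- The double sum `∑_{k<i<N} r_k r_i sin ((i-k)δ)`: twice the area between a polygonal chain and
its chord. -/
noncomputable def chainSum (r : ℕ → ℝ) (δ : ℝ) (N : ℕ) : ℝ :=
  ∑ i ∈ Finset.range N, ∑ k ∈ Finset.range i, r k * r i * Real.sin ((i - k) * δ)

/-- The direction, as a function of arc length, of the chain with edge lengths `r k` in directions
`k * δ`. -/
noncomputable def chainAngle (r : ℕ → ℝ) (δ : ℝ) (N : ℕ) (s : ℝ) : ℝ :=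
  ∑ i ∈ Finset.Ico 1 N, if ∑ k ∈ Finset.range i, r k < s then δ else 0

lemma monotone_chainAngle (r : ℕ → ℝ) {δ : ℝ} (hδ : 0 ≤ δ) (N : ℕ) : Monotone (chainAngle r δ N) := by
  intro s t hst
  refine Finset.sum_le_sum fun i _ => ?_
  split_ifs <;> first | linarith

lemma monotone_partialSum {r : ℕ → ℝ} (hr : ∀ i, 0 ≤ r i) :
    Monotone fun i => ∑ k ∈ Finset.range i, r k :=
  monotone_nat_of_le_succ fun i => by rw [Finset.sum_range_succ]; linarith [hr i]

/-- On edge `i` exactly the jumps `1, …, i` have been passed. An edge of length zero has an empty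
half-open interval, so several jumps may share a point. -/
lemma chainAngle_eq {r : ℕ → ℝ} (hr : ∀ i, 0 ≤ r i) (δ : ℝ) {N i : ℕ} (hi : i < N) {s : ℝ}
    (hs : s ∈ Set.Ioc (∑ k ∈ Finset.range i, r k) (∑ k ∈ Finset.range (i + 1), r k)) :
    chainAngle r δ N s = i * δ := by
  have hm := monotone_partialSum hr
  unfold chainAngle
  rw [← Finset.sum_filter]
  have : (Finset.Ico 1 N).filter (fun j => ∑ k ∈ Finset.range j, r k < s) = Finset.Ico 1 (i + 1) := by
    ext j
    simp only [Finset.mem_filter, Finset.mem_Ico]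
    constructor
    · rintro ⟨⟨h1, h2⟩, h3⟩
      refine ⟨h1, ?_⟩
      by_contra hj
      have := hm (not_lt.1 hj)
      exact absurd (hs.2.trans this) (not_le.2 h3)
    · rintro ⟨h1, h2⟩
      exact ⟨⟨h1, by omega⟩, (hm (Nat.lt_succ_iff.1 h2)).trans_lt hs.1⟩
  rw [this]; simp

lemma exists_mem_Ioc_partialSum (r : ℕ → ℝ) {N : ℕ} {s : ℝ}
    (hs : s ∈ Set.Ioc 0 (∑ k ∈ Finset.range N, r k)) :
    ∃ i < N, s ∈ Set.Ioc (∑ k ∈ Finset.range i, r k) (∑ k ∈ Finset.range (i + 1), r k) := by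
  induction N with
  | zero => simp at hs
  | succ n ih =>
    by_cases h : s ≤ ∑ k ∈ Finset.range n, r k
    · obtain ⟨i, hi, h'⟩ := ih ⟨hs.1, h⟩
      exact ⟨i, by omega, h'⟩
    · exact ⟨n, by omega, not_le.1 h, hs.2⟩

lemma partialSum_sub_le {r : ℕ → ℝ} {δ : ℝ} (hr : ∀ i, r i ≤ δ) {i j : ℕ} (hij : i ≤ j) :
    ∑ k ∈ Finset.range j, r k - ∑ k ∈ Finset.range i, r k ≤ ((j : ℝ) - i) * δ := by
  rw [← Finset.sum_Ico_eq_sub _ hij]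
  refine (Finset.sum_le_card_nsmul _ _ δ fun k _ => hr k).trans (le_of_eq ?_)
  simp [Nat.cast_sub hij]

lemma integral_comp_chainAngle {r : ℕ → ℝ} (hr : ∀ i, 0 ≤ r i) (δ : ℝ) (N : ℕ) (g : ℝ → ℝ) :
    ∫ s in (0:ℝ)..(∑ k ∈ Finset.range N, r k), g (chainAngle r δ N s) =
      ∑ i ∈ Finset.range N, r i * g (i * δ) := by
  have hm := monotone_partialSum hr
  have hc : ∀ i < N, Set.EqOn (fun _ => g (i * δ)) (fun s => g (chainAngle r δ N s))
      (Set.uIoc (∑ k ∈ Finset.range i, r k) (∑ k ∈ Finset.range (i + 1), r k)) := by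
    intro i hi s hs
    rw [Set.uIoc_of_le (hm (Nat.le_succ i))] at hs
    simp only [chainAngle_eq hr δ hi hs]
  have := intervalIntegral.sum_integral_adjacent_intervals (μ := volume)
    (f := fun s => g (chainAngle r δ N s)) (a := fun i => ∑ k ∈ Finset.range i, r k) (n := N)
    fun i hi => (intervalIntegrable_const (c := g (i * δ))).congr (hc i hi)
  simp only [Finset.range_zero, Finset.sum_empty] at this
  rw [← this]
  refine Finset.sum_congr rfl fun i hi => ?_
  rw [← intervalIntegral.integral_congr_ae
    (Filter.Eventually.of_forall (fun x hx => hc i (Finset.mem_range.1 hi) hx))]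
  rw [intervalIntegral.integral_const, Finset.sum_range_succ]
  simp

lemma sum_sin_abs_eq (r : ℕ → ℝ) {δ : ℝ} (hδ : 0 ≤ δ) (N : ℕ) :
    ∑ i ∈ Finset.range N, r i * ∑ k ∈ Finset.range N, r k * Real.sin |(i * δ - k * δ : ℝ)| =
      2 * chainSum r δ N := by
  unfold chainSum
  induction N with
  | zero => simp
  | succ n ih =>
    have h1 : ∀ k ∈ Finset.range n, Real.sin |(n * δ - k * δ : ℝ)| = Real.sin ((n - k) * δ) := by
      intro k hk
      have : (k : ℝ) ≤ n := by exact_mod_cast (Finset.mem_range.1 hk).le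
      rw [← sub_mul, abs_of_nonneg (mul_nonneg (by linarith) hδ)]
    have h2 : ∑ k ∈ Finset.range n, r k * (r n * Real.sin |(k * δ - n * δ : ℝ)|) =
        ∑ k ∈ Finset.range n, r k * r n * Real.sin ((n - k) * δ) :=
      Finset.sum_congr rfl fun k hk => by rw [abs_sub_comm, h1 k hk]; ring
    have h3 : r n * ∑ k ∈ Finset.range n, r k * Real.sin |(n * δ - k * δ : ℝ)| =
        ∑ k ∈ Finset.range n, r k * r n * Real.sin ((n - k) * δ) := by
      rw [Finset.mul_sum]
      exact Finset.sum_congr rfl fun k hk => by rw [h1 k hk]; ring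
    simp only [Finset.sum_range_succ, mul_add, Finset.sum_add_distrib]
    rw [ih, h2, h3]
    simp; ring

lemma integral_sin_chainAngle {r : ℕ → ℝ} (hr : ∀ i, 0 ≤ r i) {δ : ℝ} (hδ : 0 ≤ δ) (N : ℕ) :
    ∫ z, Real.sin |chainAngle r δ N z.2 - chainAngle r δ N z.1|
      ∂squareMeasure (∑ k ∈ Finset.range N, r k) = 2 * chainSum r δ N := by
  have hm := (monotone_chainAngle r hδ N).measurable
  have hi := integrable_sin_mul_abs_sub hm 1 (∑ k ∈ Finset.range N, r k)
  simp only [one_mul] at hi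
  rw [integral_square (Finset.sum_nonneg fun i _ => hr i) hi]
  simp_rw [fun t => integral_comp_chainAngle hr δ N (fun x => Real.sin |chainAngle r δ N t - x|)]
  rw [integral_comp_chainAngle hr δ N (fun y => ∑ i ∈ Finset.range N, r i * Real.sin |y - i * δ|)]
  exact sum_sin_abs_eq r hδ N

section bounds

variable {r : ℕ → ℝ} {δ : ℝ} {N : ℕ}

/-- Let `s` lie on edge `k` and `t` on edge `i`. The edges `k, …, i` cover `[s, t]`, so `t - s ≤ (i
- k + 1) δ`; the edges up to `k` and from `i` on cover the rest, so `ℓ - (t - s) ≤ (N - i + k + 1)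
δ`. The error is one edge each time. -/
lemma chain_abs_bounds (hr : ∀ i, 0 ≤ r i) (hrδ : ∀ i, r i ≤ δ) (hN : N * δ = Real.pi) {s t : ℝ}
    (hs : s ∈ Set.Ioc 0 (∑ k ∈ Finset.range N, r k)) (ht : t ∈ Set.Ioc 0 (∑ k ∈ Finset.range N, r k))
    (hst : s ≤ t) :
    |t - s| - δ ≤ |chainAngle r δ N t - chainAngle r δ N s| ∧
    |chainAngle r δ N t - chainAngle r δ N s| ≤
      Real.pi - ∑ k ∈ Finset.range N, r k + |t - s| + δ ∧
    |chainAngle r δ N t - chainAngle r δ N s| ≤ Real.pi := by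
  have hδ : 0 ≤ δ := (hr 0).trans (hrδ 0)
  obtain ⟨k, hk, hk'⟩ := exists_mem_Ioc_partialSum r hs
  obtain ⟨i, hi, hi'⟩ := exists_mem_Ioc_partialSum r ht
  have hki : k ≤ i := by
    by_contra h
    have := monotone_partialSum hr (show i + 1 ≤ k by omega)
    simp only at this
    linarith [hi'.2, hk'.1]
  have hki' : (k : ℝ) ≤ i := by exact_mod_cast hki
  have hiN : (i : ℝ) + 1 ≤ N := by exact_mod_cast hi
  rw [chainAngle_eq hr δ hk hk', chainAngle_eq hr δ hi hi', ← sub_mul,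
    abs_of_nonneg (mul_nonneg (sub_nonneg.2 hki') hδ), abs_of_nonneg (sub_nonneg.2 hst)]
  have e1 := partialSum_sub_le hrδ (show k ≤ i + 1 by omega)
  have e2 := partialSum_sub_le hrδ (show i ≤ N by omega)
  have e3 := partialSum_sub_le hrδ (show 0 ≤ k + 1 by omega)
  push_cast at e1 e3
  simp only [Finset.range_zero, Finset.sum_empty, sub_zero] at e3
  refine ⟨by linarith [hi'.2, hk'.1], ?_, ?_⟩
  · rw [← hN]
    linarith [hi'.1, hk'.2]
  · rw [← hN]
    exact mul_le_mul_of_nonneg_right (by linarith [Nat.cast_nonneg (α := ℝ) k]) hδ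

lemma chain_abs_bounds' (hr : ∀ i, 0 ≤ r i) (hrδ : ∀ i, r i ≤ δ) (hN : N * δ = Real.pi) {s t : ℝ}
    (hs : s ∈ Set.Ioc 0 (∑ k ∈ Finset.range N, r k))
    (ht : t ∈ Set.Ioc 0 (∑ k ∈ Finset.range N, r k)) :
    |t - s| - δ ≤ |chainAngle r δ N t - chainAngle r δ N s| ∧
    |chainAngle r δ N t - chainAngle r δ N s| ≤
      Real.pi - ∑ k ∈ Finset.range N, r k + |t - s| + δ ∧
    |chainAngle r δ N t - chainAngle r δ N s| ≤ Real.pi := by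
  rcases le_total s t with h | h
  · exact chain_abs_bounds hr hrδ hN hs ht h
  · rw [abs_sub_comm t s, abs_sub_comm (chainAngle r δ N t)]
    exact chain_abs_bounds hr hrδ hN ht hs h

lemma sum_le_pi (hrδ : ∀ i, r i ≤ δ) (hN : N * δ = Real.pi) :
    ∑ k ∈ Finset.range N, r k ≤ Real.pi := by
  have := partialSum_sub_le hrδ (Nat.zero_le N)
  simpa [hN] using this

theorem chainSum_ge (hr : ∀ i, 0 ≤ r i) (hrδ : ∀ i, r i ≤ δ) (hN : N * δ = Real.pi) :
    ∑ k ∈ Finset.range N, r k - Real.sin (∑ k ∈ Finset.range N, r k) - Real.pi ^ 2 * δ ≤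
      chainSum r δ N := by
  have hδ : 0 ≤ δ := (hr 0).trans (hrδ 0)
  have h0 : 0 ≤ ∑ k ∈ Finset.range N, r k := Finset.sum_nonneg fun i _ => hr i
  have hπ := sum_le_pi hrδ hN
  have := integral_sin_ge (monotone_chainAngle r hδ N) h0 hπ hδ
    (fun s hs t ht => (chain_abs_bounds' hr hrδ hN hs ht).1)
    (fun s hs t ht => (chain_abs_bounds' hr hrδ hN hs ht).2.1)
  rw [integral_sin_chainAngle hr hδ] at this
  have h2 : δ * (∑ k ∈ Finset.range N, r k) ^ 2 ≤ δ * Real.pi ^ 2 :=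
    mul_le_mul_of_nonneg_left (pow_le_pow_left₀ h0 hπ 2) hδ
  linarith

theorem chainSum_le (hr : ∀ i, 0 ≤ r i) (hrδ : ∀ i, r i ≤ δ) (hN : N * δ = Real.pi) :
    chainSum r δ N ≤ (∑ k ∈ Finset.range N, r k) ^ 2 / Real.pi := by
  have hδ : 0 ≤ δ := (hr 0).trans (hrδ 0)
  have h0 : 0 ≤ ∑ k ∈ Finset.range N, r k := Finset.sum_nonneg fun i _ => hr i
  have := integral_sin_le (monotone_chainAngle r hδ N) h0
    (fun s hs t ht => (chain_abs_bounds' hr hrδ hN hs ht).2.2)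
  rw [integral_sin_chainAngle hr hδ] at this
  linarith

end bounds

/-! ### Edges and areas from support numbers -/

/-- The length of the edge with outer normal angle `φ` of the polygon with support numbers
`h (φ + kδ)`. -/
noncomputable def edge (h : ℝ → ℝ) (δ φ : ℝ) : ℝ :=
  (h (φ + δ) + h (φ - δ) - 2 * Real.cos δ * h φ) / Real.sin δ

/-- The area of the polygon with `2N` edges whose support numbers are `h (φ + iδ)`. -/
noncomputable def polyArea (h : ℝ → ℝ) (δ : ℝ) (N : ℕ) (φ : ℝ) : ℝ :=
  (∑ i ∈ Finset.range (2 * N), h (φ + i * δ) * edge h δ (φ + i * δ)) / 2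

section algebra

variable {h : ℝ → ℝ} {δ : ℝ} {N : ℕ}

/-- The two left sides are the normal and tangential coordinates, in the frame at angle `φ + nδ`, of
the vertex shared with the preceding edge. Moving to the next vertex adds the edge to the tangential
coordinate and turns the frame by `δ`. -/
lemma support_chain (hδ : Real.sin δ ≠ 0) (φ : ℝ) (n : ℕ) :
    h (φ + n * δ) = h φ * Real.cos (n * δ) +
      (Real.cos δ * h φ - h (φ - δ)) / Real.sin δ * Real.sin (n * δ) +
      ∑ k ∈ Finset.range n, edge h δ (φ + k * δ) * Real.sin ((n - k) * δ) ∧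
    (Real.cos δ * h (φ + n * δ) - h (φ + n * δ - δ)) / Real.sin δ = -h φ * Real.sin (n * δ) +
      (Real.cos δ * h φ - h (φ - δ)) / Real.sin δ * Real.cos (n * δ) +
      ∑ k ∈ Finset.range n, edge h δ (φ + k * δ) * Real.cos ((n - k) * δ) := by
  induction n with
  | zero => simp
  | succ n ih =>
    obtain ⟨ih1, ih2⟩ := ih
    have e1 : ∀ x : ℝ, ((n + 1 : ℕ) - x) * δ = (n - x) * δ + δ := by intro x; push_cast; ring
    have e2 : ((n + 1 : ℕ) : ℝ) * δ = n * δ + δ := by push_cast; ring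
    have e3 : φ + (n * δ + δ) = (φ + n * δ) + δ := by ring
    have e4 : φ + n * δ + δ - δ = φ + n * δ := by ring
    have sq := Real.sin_sq_add_cos_sq δ
    have a1 : h (φ + n * δ + δ) = Real.cos δ * h (φ + n * δ) + Real.sin δ *
        ((Real.cos δ * h (φ + n * δ) - h (φ + n * δ - δ)) / Real.sin δ + edge h δ (φ + n * δ)) := by
      unfold edge; field_simp; ring
    have a2 : (Real.cos δ * h (φ + n * δ + δ) - h (φ + n * δ)) / Real.sin δ =
        -Real.sin δ * h (φ + n * δ) + Real.cos δ *
        ((Real.cos δ * h (φ + n * δ) - h (φ + n * δ - δ)) / Real.sin δ + edge h δ (φ + n * δ)) := by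
      unfold edge; field_simp; linear_combination h (φ + n * δ) * sq
    have s1 : ∑ k ∈ Finset.range n, edge h δ (φ + k * δ) * Real.sin ((n - k) * δ + δ) =
        Real.cos δ * (∑ k ∈ Finset.range n, edge h δ (φ + k * δ) * Real.sin ((n - k) * δ)) +
        Real.sin δ * ∑ k ∈ Finset.range n, edge h δ (φ + k * δ) * Real.cos ((n - k) * δ) := by
      rw [Finset.mul_sum, Finset.mul_sum, ← Finset.sum_add_distrib]
      exact Finset.sum_congr rfl fun k _ => by rw [Real.sin_add]; ring
    have s2 : ∑ k ∈ Finset.range n, edge h δ (φ + k * δ) * Real.cos ((n - k) * δ + δ) =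
        Real.cos δ * (∑ k ∈ Finset.range n, edge h δ (φ + k * δ) * Real.cos ((n - k) * δ)) -
        Real.sin δ * ∑ k ∈ Finset.range n, edge h δ (φ + k * δ) * Real.sin ((n - k) * δ) := by
      rw [Finset.mul_sum, Finset.mul_sum, ← Finset.sum_sub_distrib]
      exact Finset.sum_congr rfl fun k _ => by rw [Real.cos_add]; ring
    simp only [e1, e2, Finset.sum_range_succ, sub_self, zero_mul, zero_add, s1, s2, e3, e4,
      Real.sin_add (n * δ), Real.cos_add (n * δ)]
    rw [a2, a1, ih2]
    constructor
    · linear_combination Real.cos δ * ih1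
    · linear_combination -Real.sin δ * ih1

lemma sum_mul_edge (hδ : Real.sin δ ≠ 0) (φ : ℝ) (N : ℕ) :
    ∑ i ∈ Finset.range N, h (φ + i * δ) * edge h δ (φ + i * δ) =
      h φ * (∑ i ∈ Finset.range N, edge h δ (φ + i * δ) * Real.cos (i * δ)) +
      (Real.cos δ * h φ - h (φ - δ)) / Real.sin δ *
        (∑ i ∈ Finset.range N, edge h δ (φ + i * δ) * Real.sin (i * δ)) +
      chainSum (fun i => edge h δ (φ + i * δ)) δ N := by
  unfold chainSum
  rw [Finset.mul_sum, Finset.mul_sum, ← Finset.sum_add_distrib, ← Finset.sum_add_distrib]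
  refine Finset.sum_congr rfl fun i _ => ?_
  conv_lhs => rw [(support_chain (h := h) hδ φ i).1]
  have : ∑ k ∈ Finset.range i, edge h δ (φ + k * δ) * edge h δ (φ + i * δ) * Real.sin ((i - k) * δ) =
      (∑ k ∈ Finset.range i, edge h δ (φ + k * δ) * Real.sin ((i - k) * δ)) * edge h δ (φ + i * δ) := by
    rw [Finset.sum_mul]
    exact Finset.sum_congr rfl fun k _ => by ring
  rw [this]
  ring

lemma support_half_turn (hδ : Real.sin δ ≠ 0) (hN : N * δ = Real.pi) (φ : ℝ) :
    h (φ + Real.pi) = -h φ + ∑ i ∈ Finset.range N, edge h δ (φ + i * δ) * Real.sin (i * δ) ∧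
    (Real.cos δ * h (φ + Real.pi) - h (φ + Real.pi - δ)) / Real.sin δ =
      -((Real.cos δ * h φ - h (φ - δ)) / Real.sin δ) -
      ∑ i ∈ Finset.range N, edge h δ (φ + i * δ) * Real.cos (i * δ) := by
  obtain ⟨h1, h2⟩ := support_chain (h := h) hδ φ N
  rw [hN] at h1 h2
  simp only [sub_mul, hN, Real.sin_pi_sub, Real.cos_pi_sub, Real.cos_pi, Real.sin_pi] at h1 h2
  refine ⟨by rw [h1]; ring, ?_⟩
  rw [h2]
  simp only [mul_neg, Finset.sum_neg_distrib]
  ring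

/-- Splitting a polygon by the chord between two vertices with parallel support lines. -/
theorem polyArea_eq_chainSum (hper : Function.Periodic h (2 * Real.pi)) (hδ : Real.sin δ ≠ 0)
    (hN : N * δ = Real.pi) (φ : ℝ) :
    polyArea h δ N φ = (chainSum (fun i => edge h δ (φ + i * δ)) δ N +
      chainSum (fun i => edge h δ (φ + Real.pi + i * δ)) δ N) / 2 := by
  have e0 : ∑ i ∈ Finset.range (2 * N), h (φ + i * δ) * edge h δ (φ + i * δ) =
      ∑ i ∈ Finset.range N, h (φ + i * δ) * edge h δ (φ + i * δ) +
      ∑ i ∈ Finset.range N, h (φ + Real.pi + i * δ) * edge h δ (φ + Real.pi + i * δ) := by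
    rw [two_mul, Finset.sum_range_add]
    congr 1
    refine Finset.sum_congr rfl fun i _ => ?_
    have : φ + ((N + i : ℕ) : ℝ) * δ = φ + Real.pi + i * δ := by push_cast; rw [← hN]; ring
    rw [this]
  obtain ⟨a1, b1⟩ := support_half_turn (h := h) hδ hN φ
  obtain ⟨a2, b2⟩ := support_half_turn (h := h) hδ hN (φ + Real.pi)
  have p1 : h (φ + Real.pi + Real.pi) = h φ := by
    rw [show φ + Real.pi + Real.pi = φ + 2 * Real.pi by ring, hper]
  have p2 : h (φ + Real.pi + Real.pi - δ) = h (φ - δ) := by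
    rw [show φ + Real.pi + Real.pi - δ = φ - δ + 2 * Real.pi by ring, hper]
  rw [p1] at a2
  rw [p1, p2] at b2
  unfold polyArea
  rw [e0, sum_mul_edge hδ φ N, sum_mul_edge hδ (φ + Real.pi) N]
  generalize (Real.cos δ * h φ - h (φ - δ)) / Real.sin δ = b at *
  generalize (Real.cos δ * h (φ + Real.pi) - h (φ + Real.pi - δ)) / Real.sin δ = b' at *
  generalize ∑ i ∈ Finset.range N, edge h δ (φ + i * δ) * Real.sin (i * δ) = S at *
  generalize ∑ i ∈ Finset.range N, edge h δ (φ + i * δ) * Real.cos (i * δ) = C at *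
  generalize ∑ i ∈ Finset.range N, edge h δ (φ + Real.pi + i * δ) * Real.sin (i * δ) = S' at *
  generalize ∑ i ∈ Finset.range N, edge h δ (φ + Real.pi + i * δ) * Real.cos (i * δ) = C' at *
  -- The polygon closes up after two half turns. What remains besides the chain sums is `h φ * C + b
  -- * S + (S - h φ) * C - (b + C) * S = 0`.
  have hS : S' = S := by linarith
  have hC : C' = C := by linarith
  rw [hS, hC, a1, b1]
  ring

lemma sum_range_add_of_periodic {f : ℕ → ℝ} {M : ℕ} (hf : ∀ i, f (i + M) = f i) (j : ℕ) :
    ∑ i ∈ Finset.range M, f (i + j) = ∑ i ∈ Finset.range M, f i := by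
  induction j with
  | zero => simp
  | succ j ih =>
    rw [← ih]
    have h1 := Finset.sum_range_succ (fun i => f (i + j)) M
    have h2 := Finset.sum_range_succ' (fun i => f (i + j)) M
    have h3 : f (M + j) = f (0 + j) := by rw [add_comm M j, hf, zero_add]
    have h4 : ∀ i, f (i + 1 + j) = f (i + (j + 1)) := fun i => by congr 1; ring
    simp only [h4] at h2
    linarith

lemma periodic_edge (hper : Function.Periodic h (2 * Real.pi)) (δ : ℝ) :
    Function.Periodic (edge h δ) (2 * Real.pi) := by
  intro φ
  unfold edge
  rw [hper, show φ + 2 * Real.pi + δ = φ + δ + 2 * Real.pi by ring, hper,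
    show φ + 2 * Real.pi - δ = φ - δ + 2 * Real.pi by ring, hper]

lemma sum_rotate {f : ℝ → ℝ} (hf : Function.Periodic f (2 * Real.pi)) (hN : N * δ = Real.pi)
    (φ : ℝ) (j : ℕ) :
    ∑ i ∈ Finset.range (2 * N), f (φ + j * δ + i * δ) = ∑ i ∈ Finset.range (2 * N), f (φ + i * δ) := by
  rw [← sum_range_add_of_periodic (f := fun i => f (φ + i * δ)) _ j]
  · refine Finset.sum_congr rfl fun i _ => ?_
    congr 1; push_cast; ring
  · intro i
    rw [← hf (φ + i * δ), ← hN]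
    congr 1; push_cast; ring

lemma polyArea_rotate (hper : Function.Periodic h (2 * Real.pi)) (hN : N * δ = Real.pi) (φ : ℝ)
    (j : ℕ) : polyArea h δ N (φ + j * δ) = polyArea h δ N φ := by
  unfold polyArea
  rw [sum_rotate (f := fun x => h x * edge h δ x) (hper.mul (periodic_edge hper δ)) hN]

lemma sum_two_halves {f : ℝ → ℝ} (hN : N * δ = Real.pi) (φ : ℝ) :
    ∑ i ∈ Finset.range (2 * N), f (φ + i * δ) = ∑ i ∈ Finset.range N, f (φ + i * δ) +
      ∑ i ∈ Finset.range N, f (φ + Real.pi + i * δ) := by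
  rw [two_mul, Finset.sum_range_add]
  congr 1
  refine Finset.sum_congr rfl fun i _ => ?_
  congr 1; push_cast; rw [← hN]; ring

lemma chainSum_const_mul (κ : ℝ) (r : ℕ → ℝ) :
    chainSum (fun i => κ * r i) δ N = κ ^ 2 * chainSum r δ N := by
  unfold chainSum
  simp only [Finset.mul_sum]
  exact Finset.sum_congr rfl fun i _ => Finset.sum_congr rfl fun k _ => by ring

end algebra

/-! ### Area against perimeter for polygons -/

/-- The sign must change, and steps of size at most `c` cannot jump over `[-c, c]`. -/
lemma exists_abs_le_of_antiperiodic {g : ℕ → ℝ} {c : ℝ} {N : ℕ} (hg : ∀ j, |g (j + 1) - g j| ≤ c)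
    (hN : g N = -g 0) : ∃ j, |g j| ≤ c := by
  have hc : 0 ≤ c := (abs_nonneg _).trans (hg 0)
  have aux : ∀ f : ℕ → ℝ, (∀ j, |f (j + 1) - f j| ≤ c) → f 0 ≤ 0 → 0 ≤ f N → ∃ j, |f j| ≤ c := by
    intro f hf h0 hN
    by_contra! hcon
    have : ∀ n, f n < 0 := by
      intro n
      induction n with
      | zero =>
        have := hcon 0
        rw [abs_of_nonpos h0] at this; linarith
      | succ n ih =>
        by_contra! h
        have h1 := hcon (n + 1)
        rw [abs_of_nonneg h] at h1
        have h2 := (abs_le.1 (hf n)).2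
        linarith
    linarith [this N]
  rcases le_total (g 0) 0 with h | h
  · exact aux g hg h (by linarith)
  · obtain ⟨j, hj⟩ := aux (fun j => -g j) (fun j => by
      rw [← abs_neg]; convert hg j using 2; ring) (by linarith) (by linarith)
    exact ⟨j, by rwa [abs_neg] at hj⟩

section bounds

variable {h : ℝ → ℝ} {δ κ : ℝ} {N : ℕ}

/-- The chain bound holds on both sides of any chord with parallel support lines; concavity of the
sine replaces the two lengths by their mean. -/
theorem polyArea_ge (hper : Function.Periodic h (2 * Real.pi)) (hδ : Real.sin δ ≠ 0)
    (hN : N * δ = Real.pi) (h0 : ∀ φ, 0 ≤ κ * edge h δ φ) (h1 : ∀ φ, κ * edge h δ φ ≤ δ) :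
    (∑ i ∈ Finset.range (2 * N), κ * edge h δ (0 + i * δ)) / 2 -
      Real.sin ((∑ i ∈ Finset.range (2 * N), κ * edge h δ (0 + i * δ)) / 2) - Real.pi ^ 2 * δ ≤
      κ ^ 2 * polyArea h δ N 0 := by
  rw [polyArea_eq_chainSum hper hδ hN, sum_two_halves (f := fun x => κ * edge h δ x) hN]
  have a1 := chainSum_ge (r := fun i => κ * edge h δ (0 + i * δ)) (fun i => h0 _) (fun i => h1 _) hN
  have a2 := chainSum_ge (r := fun i => κ * edge h δ (0 + Real.pi + i * δ))
    (fun i => h0 _) (fun i => h1 _) hN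
  rw [chainSum_const_mul κ] at a1 a2
  have b1 := sum_le_pi (r := fun i => κ * edge h δ (0 + i * δ)) (fun i => h1 _) hN
  have b2 := sum_le_pi (r := fun i => κ * edge h δ (0 + Real.pi + i * δ)) (fun i => h1 _) hN
  have c1 : 0 ≤ ∑ i ∈ Finset.range N, κ * edge h δ (0 + i * δ) := Finset.sum_nonneg fun i _ => h0 _
  have c2 : 0 ≤ ∑ i ∈ Finset.range N, κ * edge h δ (0 + Real.pi + i * δ) :=
    Finset.sum_nonneg fun i _ => h0 _
  generalize ∑ i ∈ Finset.range N, κ * edge h δ (0 + i * δ) = x at *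
  generalize ∑ i ∈ Finset.range N, κ * edge h δ (0 + Real.pi + i * δ) = y at *
  have := strictConcaveOn_sin_Icc.concaveOn.2 (show x ∈ Set.Icc 0 Real.pi from ⟨c1, b1⟩)
    (show y ∈ Set.Icc 0 Real.pi from ⟨c2, b2⟩) (show (0 : ℝ) ≤ 1 / 2 by norm_num)
    (show (0 : ℝ) ≤ 1 / 2 by norm_num) (by norm_num)
  simp only [smul_eq_mul] at this
  rw [show 1 / 2 * x + 1 / 2 * y = (x + y) / 2 by ring] at this
  linarith

/-- The chain bounds give `(x² + y²) / (2π)`, so the lengths `x`, `y` of the two sides must nearly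
agree. Turning the starting normal by `δ` changes `x - y` by at most `2δ` and half a turn reverses
its sign, so some chord has `|x - y| ≤ 2δ`. -/
theorem polyArea_le (hper : Function.Periodic h (2 * Real.pi)) (hδ : Real.sin δ ≠ 0)
    (hN : N * δ = Real.pi) (h0 : ∀ φ, 0 ≤ κ * edge h δ φ) (h1 : ∀ φ, κ * edge h δ φ ≤ δ) :
    κ ^ 2 * polyArea h δ N 0 ≤
      (∑ i ∈ Finset.range (2 * N), κ * edge h δ (0 + i * δ) + 2 * δ) ^ 2 / (4 * Real.pi) := by
  have hper' := periodic_edge hper δ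
  have hδ0 : 0 ≤ δ := (h0 0).trans (h1 0)
  set ℓ : ℝ → ℝ := fun φ => ∑ i ∈ Finset.range N, κ * edge h δ (φ + i * δ) with hℓ
  have step : ∀ φ, ℓ (φ + δ) - ℓ φ = κ * edge h δ (φ + Real.pi) - κ * edge h δ φ := by
    intro φ
    have e1 := Finset.sum_range_succ (fun i : ℕ => κ * edge h δ (φ + i * δ)) N
    have e2 := Finset.sum_range_succ' (fun i : ℕ => κ * edge h δ (φ + i * δ)) N
    have e3 : ∀ i : ℕ, φ + ((i + 1 : ℕ) : ℝ) * δ = φ + δ + i * δ := fun i => by push_cast; ring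
    simp only [e3, hN] at e1 e2
    simp only [hℓ]
    simp only [Nat.cast_zero, zero_mul, add_zero] at e2
    linarith
  have eper : ∀ φ, edge h δ (φ + Real.pi + Real.pi) = edge h δ φ := fun φ => by
    rw [show φ + Real.pi + Real.pi = φ + 2 * Real.pi by ring, hper']
  obtain ⟨j, hj⟩ := exists_abs_le_of_antiperiodic (N := N) (c := 2 * δ)
    (g := fun j : ℕ => ℓ (j * δ) - ℓ (j * δ + Real.pi)) (by
      intro j
      have s1 := step (j * δ)
      have s2 := step (j * δ + Real.pi)
      rw [eper] at s2
      have e1 : ((j + 1 : ℕ) : ℝ) * δ = j * δ + δ := by push_cast; ring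
      have e2 : j * δ + δ + Real.pi = j * δ + Real.pi + δ := by ring
      simp only [e1, e2]
      rw [abs_le]
      constructor <;>
        linarith [h0 (j * δ), h0 (j * δ + Real.pi), h1 (j * δ), h1 (j * δ + Real.pi)]) (by
      have : ℓ (Real.pi + Real.pi) = ℓ 0 := by
        simp only [hℓ]
        refine Finset.sum_congr rfl fun i _ => ?_
        rw [show Real.pi + Real.pi + i * δ = 0 + i * δ + 2 * Real.pi by ring, hper']
      simp only [hN, this, Nat.cast_zero, zero_mul, zero_add]
      ring)
  rw [← polyArea_rotate hper hN 0 j, ← sum_rotate (f := fun x => κ * edge h δ x)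
    (fun x => by simp only [hper' x]) hN 0 j, polyArea_eq_chainSum hper hδ hN,
    sum_two_halves (f := fun x => κ * edge h δ x) hN]
  rw [zero_add ((j : ℝ) * δ)]
  have a1 := chainSum_le (r := fun i => κ * edge h δ (j * δ + i * δ))
    (fun i => h0 _) (fun i => h1 _) hN
  have a2 := chainSum_le (r := fun i => κ * edge h δ (j * δ + Real.pi + i * δ))
    (fun i => h0 _) (fun i => h1 _) hN
  rw [chainSum_const_mul κ] at a1 a2
  have c1 : 0 ≤ ∑ i ∈ Finset.range N, κ * edge h δ (j * δ + i * δ) :=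
    Finset.sum_nonneg fun i _ => h0 _
  have c2 : 0 ≤ ∑ i ∈ Finset.range N, κ * edge h δ (j * δ + Real.pi + i * δ) :=
    Finset.sum_nonneg fun i _ => h0 _
  simp only [hℓ] at hj
  generalize ∑ i ∈ Finset.range N, κ * edge h δ (j * δ + i * δ) = x at *
  generalize ∑ i ∈ Finset.range N, κ * edge h δ (j * δ + Real.pi + i * δ) = y at *
  have hpi := Real.pi_pos
  have hsq : (x - y) ^ 2 ≤ (2 * δ) ^ 2 := sq_le_sq' (abs_le.1 hj).1 (abs_le.1 hj).2
  calc _ ≤ (x ^ 2 / Real.pi + y ^ 2 / Real.pi) / 2 := by linarith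
    _ = ((x + y) ^ 2 + (x - y) ^ 2) / (4 * Real.pi) := by field_simp; ring
    _ ≤ _ := by
      gcongr
      nlinarith [mul_nonneg (add_nonneg c1 c2) hδ0]

end bounds

/-! ### The scalar inequality behind the lower bound -/

lemma sqrt_le_add_sqrt {X Y Z : ℝ} (hX : 0 ≤ X) (hY : 0 ≤ Y)
    (h : 0 ≤ Z - (X + Y) → (Z - (X + Y)) ^ 2 ≤ 4 * (X * Y)) : √Z ≤ √X + √Y := by
  rw [Real.sqrt_le_left (by positivity)]
  have hx := Real.sq_sqrt hX
  have hy := Real.sq_sqrt hY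
  have hxy : 0 ≤ √X * √Y := by positivity
  have : Z - (X + Y) ≤ 2 * (√X * √Y) := by
    rcases le_total 0 (Z - (X + Y)) with h0 | h0
    · refine le_of_sq_le_sq ?_ (by positivity)
      rw [mul_pow, mul_pow, hx, hy]
      linarith [h h0]
    · linarith
  nlinarith

/-- With `y = |t| / 2` the claim reads `y² ≤ (π - 2) sin² y`. For `y ≤ 0.6` the cubic bound gives
`sin y ≥ 0.94 y`, and `0.94² (π - 2) > 1`. The hypothesis `hc` forces `y ≤ 0.6`; without it the
claim fails at `|t| = π / 2`. -/
lemma sq_le_of_one_sub_cos {t : ℝ} (ht : |t| ≤ Real.pi / 2) (hc : 4 - Real.pi ≤ 2 * Real.cos t) :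
    t ^ 2 ≤ 2 * (Real.pi - 2) * (1 - Real.cos t) := by
  have p1 := Real.pi_gt_d4
  have p2 := Real.pi_lt_d4
  rw [← Real.cos_abs] at hc ⊢
  rw [← sq_abs]
  set y := |t| / 2 with hy
  have hy0 : 0 ≤ y := by positivity
  have ht2 : |t| = 2 * y := by rw [hy]; ring
  rw [ht2] at ht hc ⊢
  have hcos : 1 - Real.cos (2 * y) = 2 * Real.sin y ^ 2 := by
    rw [Real.cos_two_mul]; linarith [Real.sin_sq_add_cos_sq y]
  have hs := Real.sin_ge_sub_cube hy0
  have hs0 : 0 ≤ Real.sin y := Real.sin_nonneg_of_nonneg_of_le_pi hy0 (by linarith)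
  have hy6 : y ≤ 0.6 := by
    by_contra! hlt
    have h1 : Real.sin 0.6 ≤ Real.sin y :=
      Real.sin_le_sin_of_le_of_le_pi_div_two (by linarith) (by linarith) hlt.le
    have h2 := Real.sin_ge_sub_cube (x := 0.6) (by norm_num)
    have h3 : (0.56 : ℝ) ≤ Real.sin y := by norm_num at h2; linarith
    have h4 : (0.56 : ℝ) ^ 2 ≤ Real.sin y ^ 2 := pow_le_pow_left₀ (by norm_num) h3 2
    norm_num at h4
    linarith
  have h5 : 0.94 * y ≤ Real.sin y := by nlinarith [mul_nonneg hy0 (sub_nonneg.2 hy6)]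
  have h6 : (0.94 * y) ^ 2 ≤ Real.sin y ^ 2 := pow_le_pow_left₀ (by positivity) h5 2
  rw [hcos]
  nlinarith [sq_nonneg y, sq_nonneg (Real.sin y)]

/-- The sum of the square roots of the areas of a lens and its dual is at least `√(2π - 4)`. -/
lemma sqrt_lens_add_sqrt_lens {x : ℝ} (h0 : 0 ≤ x) (h1 : x ≤ Real.pi) :
    √(2 * Real.pi - 4) ≤ √(x - Real.sin x) + √(Real.pi - x - Real.sin x) := by
  have hX : 0 ≤ x - Real.sin x := sub_nonneg.2 (Real.sin_le h0)
  have hY : 0 ≤ Real.pi - x - Real.sin x := by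
    rw [← Real.sin_pi_sub]; exact sub_nonneg.2 (Real.sin_le (by linarith))
  -- With `t = x - π / 2`, squaring twice reduces the claim to `t² ≤ 2 (π - 2) (1 - cos t)`, needed
  -- only where `2 cos t ≥ 4 - π`.
  refine sqrt_le_add_sqrt hX hY fun h => ?_
  have hs : Real.sin x = Real.cos (x - Real.pi / 2) := (Real.cos_sub_pi_div_two x).symm
  have ht : |x - Real.pi / 2| ≤ Real.pi / 2 := by rw [abs_le]; constructor <;> linarith
  have := sq_le_of_one_sub_cos ht (by rw [← hs]; linarith)
  rw [← hs] at this
  nlinarith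

/-! ### Dual polygons and the passage to the limit -/

/-- The ratio of the angle `δ` to the edge length of the polygon with angles `δ` circumscribed to
the unit disc. -/
noncomputable def edgeScale (δ : ℝ) : ℝ := Real.cos (δ / 2) / Real.sinc (δ / 2)

/-- The scale is `(δ / 2) / tan (δ / 2)`; written with `sinc` it is continuous at `0`. -/
lemma tendsto_edgeScale : Filter.Tendsto edgeScale (nhds 0) (nhds 1) := by
  have : ContinuousAt edgeScale 0 := by
    unfold edgeScale
    refine ContinuousAt.div (by fun_prop) ?_ (by simp)
    exact (Real.continuous_sinc.comp (by fun_prop : Continuous fun δ : ℝ => δ / 2)).continuousAt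
  have h := this.tendsto
  simpa [edgeScale] using h

section

variable {δ : ℝ}

lemma sin_half_pos (hδ : δ ∈ Set.Ioc 0 (Real.pi / 2)) : 0 < Real.sin (δ / 2) :=
  Real.sin_pos_of_pos_of_lt_pi (by linarith [hδ.1]) (by linarith [hδ.1, hδ.2])

lemma cos_half_pos (hδ : δ ∈ Set.Ioc 0 (Real.pi / 2)) : 0 < Real.cos (δ / 2) :=
  Real.cos_pos_of_mem_Ioo ⟨by linarith [hδ.1, hδ.2], by linarith [hδ.1, hδ.2]⟩

lemma sin_pos_of_mem (hδ : δ ∈ Set.Ioc 0 (Real.pi / 2)) : 0 < Real.sin δ :=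
  Real.sin_pos_of_pos_of_lt_pi hδ.1 (by linarith [hδ.1, hδ.2])

lemma edgeScale_pos (hδ : δ ∈ Set.Ioc 0 (Real.pi / 2)) : 0 < edgeScale δ := by
  have h := hδ.1
  unfold edgeScale
  rw [Real.sinc_of_ne_zero (by positivity)]
  have := sin_half_pos hδ
  have := cos_half_pos hδ
  positivity

lemma edgeScale_mul (hδ : δ ∈ Set.Ioc 0 (Real.pi / 2)) :
    edgeScale δ * ((2 - 2 * Real.cos δ) / Real.sin δ) = δ := by
  have h := hδ.1.ne'
  have h1 := (sin_half_pos hδ).ne'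
  have h2 := (cos_half_pos hδ).ne'
  unfold edgeScale
  rw [Real.sinc_of_ne_zero (by positivity)]
  have e1 : Real.cos δ = 1 - 2 * Real.sin (δ / 2) ^ 2 := by
    have := Real.cos_two_mul (δ / 2)
    rw [mul_div_cancel₀ δ two_ne_zero] at this
    linarith [Real.sin_sq_add_cos_sq (δ / 2)]
  have e2 : Real.sin δ = 2 * Real.sin (δ / 2) * Real.cos (δ / 2) := by
    rw [← Real.sin_two_mul]; ring_nf
  rw [e1, e2]
  field_simp
  ring

end

/-- The discrete form of radii of curvature adding up to `1`: the constant `1` contributes the edge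
`2 tan (δ / 2)` of the polygon around the unit disc. -/
lemma edge_dual (h : ℝ → ℝ) (δ φ : ℝ) :
    edge (fun x => 1 - h (x + Real.pi)) δ φ =
      (2 - 2 * Real.cos δ) / Real.sin δ - edge h δ (φ + Real.pi) := by
  unfold edge
  beta_reduce
  rw [show φ + δ + Real.pi = φ + Real.pi + δ by ring, show φ - δ + Real.pi = φ + Real.pi - δ by ring]
  ring

/-- Half the scaled perimeter of a polygon and of its dual add up to `π`. -/
theorem polyArea_dual_bounds {h : ℝ → ℝ} (hper : Function.Periodic h (2 * Real.pi)) {δ : ℝ} {N : ℕ}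
    (hδ : δ ∈ Set.Ioc 0 (Real.pi / 2)) (hN : N * δ = Real.pi)
    (h0 : ∀ φ, 0 ≤ edge h δ φ) (h1 : ∀ φ, edge h δ φ ≤ (2 - 2 * Real.cos δ) / Real.sin δ) :
    ∃ x ∈ Set.Icc 0 Real.pi,
      x - Real.sin x - Real.pi ^ 2 * δ ≤ edgeScale δ ^ 2 * polyArea h δ N 0 ∧
      Real.pi - x - Real.sin x - Real.pi ^ 2 * δ ≤
        edgeScale δ ^ 2 * polyArea (fun φ => 1 - h (φ + Real.pi)) δ N 0 ∧
      edgeScale δ ^ 2 * polyArea h δ N 0 ≤ (x + δ) ^ 2 / Real.pi ∧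
      edgeScale δ ^ 2 * polyArea (fun φ => 1 - h (φ + Real.pi)) δ N 0 ≤
        (Real.pi - x + δ) ^ 2 / Real.pi := by
  have hκ := edgeScale_pos hδ
  have hκe := edgeScale_mul hδ
  have hs := (sin_pos_of_mem hδ).ne'
  set κ := edgeScale δ
  set h' : ℝ → ℝ := fun φ => 1 - h (φ + Real.pi) with hh'
  have hper' : Function.Periodic h' (2 * Real.pi) := fun φ => by
    simp only [hh']
    rw [show φ + 2 * Real.pi + Real.pi = φ + Real.pi + 2 * Real.pi by ring, hper]
  have a0 : ∀ φ, 0 ≤ κ * edge h δ φ := fun φ => mul_nonneg hκ.le (h0 φ)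
  have a1 : ∀ φ, κ * edge h δ φ ≤ δ := fun φ =>
    (mul_le_mul_of_nonneg_left (h1 φ) hκ.le).trans_eq hκe
  have hdual : ∀ φ, κ * edge h' δ φ = δ - κ * edge h δ (φ + Real.pi) := fun φ => by
    rw [hh', edge_dual, mul_sub, hκe]
  have b0 : ∀ φ, 0 ≤ κ * edge h' δ φ := fun φ => by rw [hdual]; linarith [a1 (φ + Real.pi)]
  have b1 : ∀ φ, κ * edge h' δ φ ≤ δ := fun φ => by rw [hdual]; linarith [a0 (φ + Real.pi)]
  have per := periodic_edge hper δ
  -- Scaled edges at opposite normals add up to `δ`, and there are `2N` of them.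
  have hsum : ∑ i ∈ Finset.range (2 * N), κ * edge h' δ (0 + i * δ) =
      2 * Real.pi - ∑ i ∈ Finset.range (2 * N), κ * edge h δ (0 + i * δ) := by
    have e := sum_rotate (f := fun x => κ * edge h δ x) (fun x => by simp only [per x]) hN 0 N
    rw [hN] at e
    simp only [hdual, Finset.sum_sub_distrib]
    rw [← e]
    congr 1
    · simp; rw [← hN]; ring
    · exact Finset.sum_congr rfl fun i _ => by
        rw [show (0:ℝ) + i * δ + Real.pi = 0 + Real.pi + i * δ by ring]
  have l1 := polyArea_ge hper hs hN a0 a1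
  have l2 := polyArea_ge hper' hs hN b0 b1
  have u1 := polyArea_le hper hs hN a0 a1
  have u2 := polyArea_le hper' hs hN b0 b1
  have p0 : 0 ≤ ∑ i ∈ Finset.range (2 * N), κ * edge h δ (0 + i * δ) :=
    Finset.sum_nonneg fun i _ => a0 _
  have p1 : 0 ≤ ∑ i ∈ Finset.range (2 * N), κ * edge h' δ (0 + i * δ) :=
    Finset.sum_nonneg fun i _ => b0 _
  rw [hsum] at l2 u2 p1
  generalize ∑ i ∈ Finset.range (2 * N), κ * edge h δ (0 + i * δ) = P at *
  have hsin : Real.sin ((2 * Real.pi - P) / 2) = Real.sin (P / 2) := by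
    rw [← Real.sin_pi_sub]; ring_nf
  rw [hsin] at l2
  refine ⟨P / 2, ⟨by linarith, by linarith⟩, l1, by linarith, u1.trans_eq ?_, u2.trans_eq ?_⟩
  · field_simp; ring
  · field_simp; ring

/-- The two inequalities for a pair of areas that are limits of areas of dual polygons. -/
theorem sqrt_area_bounds_of_tendsto {h : ℝ → ℝ} (hper : Function.Periodic h (2 * Real.pi))
    (h0 : ∀ δ ∈ Set.Ioc 0 (Real.pi / 2), ∀ φ, 0 ≤ edge h δ φ)
    (h1 : ∀ δ ∈ Set.Ioc 0 (Real.pi / 2), ∀ φ, edge h δ φ ≤ (2 - 2 * Real.cos δ) / Real.sin δ)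
    {a b : ℝ}
    (ha : Filter.Tendsto (fun k : ℕ => polyArea h (Real.pi / 2 ^ (k + 1)) (2 ^ (k + 1)) 0)
      Filter.atTop (nhds a))
    (hb : Filter.Tendsto (fun k : ℕ => polyArea (fun φ => 1 - h (φ + Real.pi))
      (Real.pi / 2 ^ (k + 1)) (2 ^ (k + 1)) 0) Filter.atTop (nhds b)) :
    √(2 * Real.pi - 4) ≤ √a + √b ∧ √a + √b ≤ √Real.pi := by
  have hpi := Real.pi_pos
  set δ : ℕ → ℝ := fun k => Real.pi / 2 ^ (k + 1) with hδ
  have hδm : ∀ k, δ k ∈ Set.Ioc 0 (Real.pi / 2) := fun k => by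
    refine ⟨by positivity, ?_⟩
    refine div_le_div_of_nonneg_left hpi.le two_pos ?_
    exact le_self_pow₀ one_le_two (by omega)
  have hN : ∀ k, ((2 ^ (k + 1) : ℕ) : ℝ) * δ k = Real.pi := fun k => by
    simp only [hδ]; push_cast; field_simp
  have hδ0 : Filter.Tendsto δ Filter.atTop (nhds 0) := by
    have h2 : Filter.Tendsto (fun k : ℕ => (2 : ℝ) ^ (k + 1)) Filter.atTop Filter.atTop :=
      (Filter.tendsto_add_atTop_iff_nat 1).2 (tendsto_pow_atTop_atTop_of_one_lt one_lt_two)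
    exact h2.const_div_atTop Real.pi
  have hκ : Filter.Tendsto (fun k => edgeScale (δ k) ^ 2) Filter.atTop (nhds 1) := by
    simpa using (tendsto_edgeScale.comp hδ0).pow 2
  have ha' := hκ.mul ha
  have hb' := hκ.mul hb
  rw [one_mul] at ha' hb'
  have key := fun k => polyArea_dual_bounds hper (hδm k) (hN k) (h0 _ (hδm k)) (h1 _ (hδm k))
  constructor
  · have hc : Filter.Tendsto (fun k => Real.pi ^ 2 * δ k) Filter.atTop (nhds 0) := by
      simpa using hδ0.const_mul (Real.pi ^ 2)
    have lim := (ha'.add hc).sqrt.add (hb'.add hc).sqrt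
    rw [add_zero, add_zero] at lim
    refine ge_of_tendsto' lim fun k => ?_
    -- The half perimeter `x` varies with `k`, but the scalar bound is uniform in it, so its
    -- convergence is not needed.
    obtain ⟨x, hx, l1, l2, -, -⟩ := key k
    refine (sqrt_lens_add_sqrt_lens hx.1 hx.2).trans (add_le_add (Real.sqrt_le_sqrt ?_)
      (Real.sqrt_le_sqrt ?_)) <;> linarith
  · have lim := ha'.sqrt.add hb'.sqrt
    have limr : Filter.Tendsto (fun k => √Real.pi + 2 * δ k / √Real.pi) Filter.atTop
        (nhds (√Real.pi)) := by
      simpa using ((hδ0.const_mul 2).div_const (√Real.pi)).const_add (√Real.pi)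
    refine le_of_tendsto_of_tendsto' lim limr fun k => ?_
    obtain ⟨x, hx, -, -, u1, u2⟩ := key k
    have hd := (hδm k).1
    have s1 := Real.sqrt_le_sqrt u1
    have s2 := Real.sqrt_le_sqrt u2
    rw [Real.sqrt_div (by positivity), Real.sqrt_sq (by linarith [hx.1, hx.2])] at s1 s2
    refine (add_le_add s1 s2).trans (le_of_eq ?_)
    have hsq : √Real.pi * √Real.pi = Real.pi := Real.mul_self_sqrt hpi.le
    have hsp : √Real.pi ≠ 0 := by positivity
    field_simp
    rw [sq, hsq]; ring

/-! ### Linear functionals and directions in the plane -/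

/-- The Euclidean plane. -/
abbrev Plane := EuclideanSpace ℝ (Fin 2)

lemma plane_dist_sq (x y : Plane) : dist x y ^ 2 = (x 0 - y 0) ^ 2 + (x 1 - y 1) ^ 2 := by
  rw [EuclideanSpace.dist_eq, Real.sq_sqrt (Finset.sum_nonneg fun i _ => sq_nonneg _)]
  simp [Real.dist_eq, sq_abs]

lemma plane_norm_sq (x : Plane) : ‖x‖ ^ 2 = x 0 ^ 2 + x 1 ^ 2 := by
  have := plane_dist_sq x 0
  simpa using this

/-- The linear functional `x ↦ ⟪x, (cos φ, sin φ)⟫`. -/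
noncomputable def lin (φ : ℝ) (x : Plane) : ℝ := x 0 * Real.cos φ + x 1 * Real.sin φ

lemma continuous_lin (φ : ℝ) : Continuous (lin φ) := by
  unfold lin; fun_prop

lemma lin_sub (φ : ℝ) (x y : Plane) : lin φ (x - y) = lin φ x - lin φ y := by
  simp [lin]; ring

lemma lin_add (φ : ℝ) (x y : Plane) : lin φ (x + y) = lin φ x + lin φ y := by
  simp [lin]; ring

lemma lin_smul (φ c : ℝ) (x : Plane) : lin φ (c • x) = c * lin φ x := by
  simp [lin]; ring

lemma lin_add_pi (φ : ℝ) (x : Plane) : lin (φ + Real.pi) x = -lin φ x := by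
  simp [lin]; ring

lemma lin_angle_add (φ α : ℝ) (x : Plane) :
    lin (φ + α) x = lin φ x * Real.cos α + lin (φ + Real.pi / 2) x * Real.sin α := by
  simp only [lin, Real.cos_add, Real.sin_add, Real.cos_pi_div_two, Real.sin_pi_div_two]
  ring

lemma periodic_lin (x : Plane) : Function.Periodic (fun φ => lin φ x) (2 * Real.pi) := fun φ => by
  simp [lin]

lemma lin_sq_add_sq (φ : ℝ) (x : Plane) :
    lin φ x ^ 2 + lin (φ + Real.pi / 2) x ^ 2 = x 0 ^ 2 + x 1 ^ 2 := by
  simp only [lin, Real.cos_add_pi_div_two, Real.sin_add_pi_div_two]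
  linear_combination (x 0 ^ 2 + x 1 ^ 2) * Real.sin_sq_add_cos_sq φ

lemma lin_le_norm (φ : ℝ) (x : Plane) : lin φ x ≤ ‖x‖ := by
  refine le_of_sq_le_sq ?_ (norm_nonneg _)
  rw [plane_norm_sq, ← lin_sq_add_sq φ]
  nlinarith [sq_nonneg (lin (φ + Real.pi / 2) x)]

/-- The unit vector with direction `φ`. -/
noncomputable def unitVec (φ : ℝ) : Plane := !₂[Real.cos φ, Real.sin φ]

lemma lin_unitVec (φ : ℝ) : lin φ (unitVec φ) = 1 := by
  simp [lin, unitVec, ← sq]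

lemma norm_unitVec (φ : ℝ) : ‖unitVec φ‖ = 1 := by
  rw [← sq_eq_sq₀ (norm_nonneg _) zero_le_one, plane_norm_sq]
  simp [unitVec]

lemma exists_lin_eq_norm (x : Plane) : ∃ φ, lin φ x = ‖x‖ := by
  set z : ℂ := ⟨x 0, x 1⟩ with hz
  have h1 := Complex.norm_mul_cos_arg z
  have h2 := Complex.norm_mul_sin_arg z
  have h3 : ‖z‖ = ‖x‖ := by
    rw [← sq_eq_sq₀ (norm_nonneg _) (norm_nonneg _), plane_norm_sq, Complex.sq_norm, Complex.normSq_apply]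
    simp [hz]; ring
  refine ⟨z.arg, ?_⟩
  have e : x 0 = z.re ∧ x 1 = z.im := ⟨rfl, rfl⟩
  rw [lin, e.1, e.2, ← h1, ← h2, ← h3]
  linear_combination ‖z‖ * Real.sin_sq_add_cos_sq z.arg

/-! ### Ball-bodies -/

section ballbodies

variable {n : ℕ} {A K : Set (EuclideanSpace ℝ (Fin n))}

lemma mem_cDual {x : EuclideanSpace ℝ (Fin n)} : x ∈ cDual A ↔ ∀ a ∈ A, dist x a ≤ 1 := by
  simp [cDual]

lemma cDual_mem_ballBodies (A : Set (EuclideanSpace ℝ (Fin n))) : cDual A ∈ ballBodies n := ⟨A, rfl⟩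

lemma subset_cDual_cDual (A : Set (EuclideanSpace ℝ (Fin n))) : A ⊆ cDual (cDual A) := by
  intro x hx
  rw [mem_cDual]
  intro y hy
  rw [dist_comm]
  exact mem_cDual.1 hy x hx

lemma cDual_antitone {A B : Set (EuclideanSpace ℝ (Fin n))} (h : A ⊆ B) : cDual B ⊆ cDual A := by
  intro x hx
  rw [mem_cDual] at *
  exact fun a ha => hx a (h ha)

lemma cDual_cDual (hK : K ∈ ballBodies n) : cDual (cDual K) = K := by
  obtain ⟨A, rfl⟩ := hK
  exact (cDual_antitone (subset_cDual_cDual A)).antisymm (subset_cDual_cDual _)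

lemma isClosed_of_mem_ballBodies (hK : K ∈ ballBodies n) : IsClosed K := by
  obtain ⟨A, rfl⟩ := hK
  exact isClosed_biInter fun _ _ => isClosed_closedBall

lemma cDual_nonempty (hK : K ∈ ballBodies n) (h : K ≠ Set.univ) : (cDual K).Nonempty := by
  obtain ⟨A, rfl⟩ := hK
  rcases A.eq_empty_or_nonempty with rfl | ⟨a, ha⟩
  · simp at h
  · exact ⟨a, subset_cDual_cDual A ha⟩

lemma isCompact_of_cDual_nonempty (hK : K ∈ ballBodies n) (h : (cDual K).Nonempty) : IsCompact K := by
  obtain ⟨a, ha⟩ := h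
  refine (isCompact_closedBall a 1).of_isClosed_subset (isClosed_of_mem_ballBodies hK) fun x hx => ?_
  rw [mem_closedBall, dist_comm]
  exact mem_cDual.1 ha x hx

/-- Uniform convexity of the unit ball: with `ρ` the small radius, the new centre has squared
distance at most `1 - 2ρ ≤ (1 - ρ)²` from `a`. -/
lemma closedBall_subset_closedBall_of_mem {y z a : EuclideanSpace ℝ (Fin n)} (hy : y ∈ closedBall a 1)
    (hz : z ∈ closedBall a 1) {t : ℝ} (ht : t ∈ Set.Icc (0 : ℝ) 1) :
    closedBall (y + t • (z - y)) (t * (1 - t) * ‖z - y‖ ^ 2 / 2) ⊆ closedBall a 1 := by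
  have hy' : ‖y - a‖ ≤ 1 := by rwa [← dist_eq_norm]
  have hz' : ‖z - a‖ ≤ 1 := by rwa [← dist_eq_norm]
  set ρ := t * (1 - t) * ‖z - y‖ ^ 2 / 2 with hρ
  have ht0 := ht.1
  have ht1 := sub_nonneg.2 ht.2
  have id : ‖y + t • (z - y) - a‖ ^ 2 =
      (1 - t) * ‖y - a‖ ^ 2 + t * ‖z - a‖ ^ 2 - t * (1 - t) * ‖z - y‖ ^ 2 := by
    have e1 : y + t • (z - y) - a = (1 - t) • (y - a) + t • (z - a) := by module
    have e2 : z - y = (z - a) - (y - a) := by abel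
    rw [e1, e2]
    generalize y - a = p, z - a = q
    rw [norm_add_sq_real, norm_sub_sq_real, norm_smul, norm_smul, real_inner_smul_left,
      real_inner_smul_right, real_inner_comm p q, mul_pow, mul_pow, Real.norm_eq_abs,
      Real.norm_eq_abs, sq_abs, sq_abs]
    ring
  have h1 : ‖y - a‖ ^ 2 ≤ 1 := pow_le_one₀ (norm_nonneg _) hy'
  have h2 : ‖z - a‖ ^ 2 ≤ 1 := pow_le_one₀ (norm_nonneg _) hz'
  have h3 : ‖z - y‖ ≤ 2 := by
    have : z - y = (z - a) - (y - a) := by abel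
    rw [this]; exact (norm_sub_le _ _).trans (by linarith)
  have h4 : ‖z - y‖ ^ 2 ≤ 4 := by nlinarith [norm_nonneg (z - y)]
  have h5 : t * (1 - t) ≤ 1 / 4 := by nlinarith [sq_nonneg (t - 1 / 2)]
  have hρ1 : ρ ≤ 1 / 2 := by
    have := mul_le_mul h5 h4 (by positivity) (by norm_num)
    rw [hρ]; linarith
  have h6 : ‖y + t • (z - y) - a‖ ^ 2 ≤ 1 - 2 * ρ := by
    have := mul_le_mul_of_nonneg_left h1 ht1
    have := mul_le_mul_of_nonneg_left h2 ht0
    rw [id]; linarith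
  have h7 : ‖y + t • (z - y) - a‖ ≤ 1 - ρ := by
    refine le_of_sq_le_sq ?_ (by linarith)
    nlinarith [sq_nonneg ρ]
  refine closedBall_subset_closedBall' ?_
  rw [dist_eq_norm]
  linarith

/-- A ball-body contains small balls around the inner points of its segments. -/
lemma closedBall_subset_of_mem_ballBodies (hK : K ∈ ballBodies n) {y z : EuclideanSpace ℝ (Fin n)}
    (hy : y ∈ K) (hz : z ∈ K) {t : ℝ} (ht : t ∈ Set.Icc (0 : ℝ) 1) :
    closedBall (y + t • (z - y)) (t * (1 - t) * ‖z - y‖ ^ 2 / 2) ⊆ K := by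
  obtain ⟨A, rfl⟩ := hK
  refine Set.subset_iInter₂ fun a ha => ?_
  exact closedBall_subset_closedBall_of_mem (Set.mem_iInter₂.1 hy a ha) (Set.mem_iInter₂.1 hz a ha) ht

end ballbodies

/-! ### Support functions -/

/-- The support function of a planar set, as a function of the angle. -/
noncomputable def supp (K : Set Plane) (φ : ℝ) : ℝ := sSup (lin φ '' K)

section support

variable {K : Set Plane}

lemma lin_le_supp (hK : IsCompact K) (φ : ℝ) {x : Plane} (hx : x ∈ K) : lin φ x ≤ supp K φ :=
  le_csSup (hK.image (continuous_lin φ)).bddAbove ⟨x, hx, rfl⟩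

lemma exists_lin_eq_supp (hK : IsCompact K) (hne : K.Nonempty) (φ : ℝ) :
    ∃ x ∈ K, lin φ x = supp K φ :=
  (hK.image (continuous_lin φ)).sSup_mem (hne.image _)

lemma periodic_supp (K : Set Plane) : Function.Periodic (supp K) (2 * Real.pi) := fun φ => by
  unfold supp
  congr 1
  exact Set.image_congr fun x _ => periodic_lin x φ

lemma sin_mul_lin (a b c : ℝ) (x : Plane) :
    lin b x * Real.sin (c - a) = lin a x * Real.sin (c - b) + lin c x * Real.sin (b - a) := by
  simp only [lin, Real.sin_sub]
  ring

/-- Sublinearity of a function on the circle. -/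
def AngleSublinear (h : ℝ → ℝ) : Prop :=
  ∀ a b c : ℝ, a ≤ b → b ≤ c → c ≤ a + Real.pi →
    h b * Real.sin (c - a) ≤ h a * Real.sin (c - b) + h c * Real.sin (b - a)

lemma angleSublinear_supp (hK : IsCompact K) (hne : K.Nonempty) : AngleSublinear (supp K) := by
  intro a b c hab hbc hca
  obtain ⟨x, hx, hxb⟩ := exists_lin_eq_supp hK hne b
  rw [← hxb, sin_mul_lin]
  have s1 : 0 ≤ Real.sin (c - b) := Real.sin_nonneg_of_nonneg_of_le_pi (by linarith) (by linarith)
  have s2 : 0 ≤ Real.sin (b - a) := Real.sin_nonneg_of_nonneg_of_le_pi (by linarith) (by linarith)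
  exact add_le_add (mul_le_mul_of_nonneg_right (lin_le_supp hK a hx) s1)
    (mul_le_mul_of_nonneg_right (lin_le_supp hK c hx) s2)

lemma AngleSublinear.edge_nonneg {h : ℝ → ℝ} (hh : AngleSublinear h) {δ : ℝ}
    (hδ : δ ∈ Set.Ioc 0 (Real.pi / 2)) (φ : ℝ) : 0 ≤ edge h δ φ := by
  have hs := sin_pos_of_mem hδ
  have := hh (φ - δ) φ (φ + δ) (by linarith [hδ.1]) (by linarith [hδ.1]) (by linarith [hδ.2])
  rw [show φ + δ - (φ - δ) = 2 * δ by ring, add_sub_cancel_left, sub_sub_cancel, Real.sin_two_mul] at this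
  refine div_nonneg ?_ hs.le
  refine nonneg_of_mul_nonneg_left (b := Real.sin δ) ?_ hs
  linarith

/-- The support functions of a ball-body and of its dual. -/
theorem supp_cDual (hK : K ∈ ballBodies 2) (hne : K.Nonempty) (hne' : (cDual K).Nonempty) (φ : ℝ) :
    supp (cDual K) φ = 1 - supp K (φ + Real.pi) := by
  have cK := isCompact_of_cDual_nonempty hK hne'
  have cK' := isCompact_of_cDual_nonempty (cDual_mem_ballBodies K) (by rwa [cDual_cDual hK])
  obtain ⟨y, hy, hyφ⟩ := exists_lin_eq_supp cK hne (φ + Real.pi)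
  obtain ⟨y', hy', hyφ'⟩ := exists_lin_eq_supp cK' hne' φ
  apply le_antisymm
  · rw [← hyφ', ← hyφ, lin_add_pi]
    have h1 := lin_le_norm φ (y' - y)
    have h2 := mem_cDual.1 hy' y hy
    rw [dist_eq_norm] at h2
    rw [lin_sub] at h1
    linarith
  -- It suffices that the unit disc about `y - u`, which has `y` on its boundary with outer normal
  -- `u`, contains `K`. If some `z ∈ K` were outside it, a small ball around a point of the segment
  -- from `y` to `z` would cross the supporting line at `y`.
  · set u := unitVec (φ + Real.pi) with hu
    have hmem : y - u ∈ cDual K := by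
      rw [mem_cDual]
      intro z hz
      by_contra! hlt
      have hd : 1 < ‖(z - y) + u‖ ^ 2 := by
        rw [show (z - y) + u = -(y - u - z) by abel, norm_neg, ← dist_eq_norm]
        exact one_lt_pow₀ hlt two_ne_zero
      set d := z - y with hdd
      have hdu : ‖d + u‖ ^ 2 = ‖d‖ ^ 2 + 2 * lin (φ + Real.pi) d + 1 := by
        rw [plane_norm_sq, plane_norm_sq, hu, unitVec, lin]
        simp only [PiLp.add_apply, Matrix.cons_val_zero, Matrix.cons_val_one,
          Matrix.cons_val_fin_one]
        linear_combination Real.sin_sq_add_cos_sq (φ + Real.pi)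
      set q := lin (φ + Real.pi) d with hq
      have hpos : 0 < ‖d‖ ^ 2 / 2 + q := by linarith
      have hq0 : q ≤ 0 := by
        rw [hq, hdd, lin_sub, hyφ]
        linarith [lin_le_supp cK (φ + Real.pi) hz]
      have hd2 : 0 < ‖d‖ ^ 2 := by linarith
      -- a point of `K` beyond the supporting line at `y`
      obtain ⟨t, ht0, ht1, htq⟩ : ∃ t : ℝ, 0 < t ∧ t ≤ 1 ∧ t * (‖d‖ ^ 2 / 2) < ‖d‖ ^ 2 / 2 + q := by
        -- The ball about `y + t d` reaches height `t (q + (1 - t) ‖d‖² / 2)` above the supporting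
        -- line; the witness is half the bound below which this is positive.
        refine ⟨(‖d‖ ^ 2 / 2 + q) / ‖d‖ ^ 2, by positivity, ?_, ?_⟩
        · rw [div_le_one hd2]; linarith
        · rw [div_mul_div_comm, mul_comm, mul_div_mul_left _ _ hd2.ne']
          linarith
      set ρ := t * (1 - t) * ‖d‖ ^ 2 / 2 with hρ
      have hρ0 : 0 ≤ ρ := by
        have := sub_nonneg.2 ht1
        positivity
      have hw : y + t • d + ρ • u ∈ K := by
        refine closedBall_subset_of_mem_ballBodies hK hy hz ⟨ht0.le, ht1⟩ ?_
        rw [mem_closedBall, dist_eq_norm, add_sub_cancel_left, norm_smul, hu, norm_unitVec, mul_one,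
          Real.norm_eq_abs, abs_of_nonneg hρ0]
      have := lin_le_supp cK (φ + Real.pi) hw
      rw [lin_add, lin_add, lin_smul, lin_smul, hu, lin_unitVec, hyφ, ← hq, hρ] at this
      nlinarith
    have := lin_le_supp cK' φ hmem
    have e : lin φ u = -1 := by
      have := lin_unitVec (φ + Real.pi)
      rw [lin_add_pi] at this
      rw [hu]; linarith
    rw [lin_sub, e] at this
    rw [← hyφ, lin_add_pi]
    linarith

end support

/-! ### Area in rotated coordinates -/

lemma volume_preserving_coords :
    MeasurePreserving (fun x : Plane => (x 0, x 1)) volume volume :=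
  (volume_preserving_finTwoArrow ℝ).comp
    (EuclideanSpace.volume_preserving_symm_measurableEquiv_toLp (Fin 2))

/-- The coordinates of a point in the orthonormal frame with directions `φ` and `φ + π / 2`. -/
noncomputable def frame (φ : ℝ) : Plane ≃ₗᵢ[ℝ] Plane :=
  LinearIsometry.toLinearIsometryEquiv
    { toFun := fun x => !₂[lin φ x, lin (φ + Real.pi / 2) x]
      map_add' := fun x y => by
        ext i; fin_cases i <;> simp [lin_add]
      map_smul' := fun c x => by
        ext i; fin_cases i <;> simp [lin_smul]
      norm_map' := fun x => by
        rw [← sq_eq_sq₀ (norm_nonneg _) (norm_nonneg _), plane_norm_sq, plane_norm_sq,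
          ← lin_sq_add_sq φ x]
        simp } rfl

lemma frame_apply (φ : ℝ) (x : Plane) : frame φ x = !₂[lin φ x, lin (φ + Real.pi / 2) x] := rfl

lemma volume_frame (φ : ℝ) {S : Set (ℝ × ℝ)} (hS : MeasurableSet S) :
    volume {x : Plane | (lin φ x, lin (φ + Real.pi / 2) x) ∈ S} = volume S :=
  (volume_preserving_coords.comp (frame φ).measurePreserving).measure_preimage hS.nullMeasurableSet

/-- The region between the graphs of `f` and `g` over `[a, b]`. -/
def closedRegion (f g : ℝ → ℝ) (a b : ℝ) : Set (ℝ × ℝ) :=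
  {p | p.1 ∈ Set.Icc a b ∧ p.2 ∈ Set.Icc (f p.1) (g p.1)}

lemma isClosed_closedRegion {f g : ℝ → ℝ} (hf : Continuous f) (hg : Continuous g) (a b : ℝ) :
    IsClosed (closedRegion f g a b) := by
  refine IsClosed.inter (isClosed_Icc.preimage continuous_fst) (IsClosed.inter ?_ ?_)
  · exact isClosed_le (hf.comp continuous_fst) continuous_snd
  · exact isClosed_le continuous_snd (hg.comp continuous_fst)

lemma volume_closedRegion {f g : ℝ → ℝ} (hf : Continuous f) (hg : Continuous g) {a b : ℝ}
    (hab : a ≤ b) (hfg : ∀ x ∈ Set.Icc a b, f x ≤ g x) :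
    volume (closedRegion f g a b) = ENNReal.ofReal (∫ x in a..b, (g x - f x)) := by
  have hsec : ∀ x, volume (Prod.mk x ⁻¹' closedRegion f g a b) =
      (Set.Icc a b).indicator (fun x => ENNReal.ofReal (g x - f x)) x := by
    intro x
    by_cases hx : x ∈ Set.Icc a b
    · have : Prod.mk x ⁻¹' closedRegion f g a b = Set.Icc (f x) (g x) := by
        ext y; exact ⟨fun h => h.2, fun h => ⟨hx, h⟩⟩
      rw [Set.indicator_of_mem hx, this, Real.volume_Icc]
    · have : Prod.mk x ⁻¹' closedRegion f g a b = ∅ := by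
        ext y; exact ⟨fun h => (hx h.1).elim, fun h => h.elim⟩
      rw [Set.indicator_of_notMem hx, this, measure_empty]
  have hi : IntegrableOn (fun x => g x - f x) (Set.Icc a b) :=
    (hg.sub hf).continuousOn.integrableOn_compact isCompact_Icc
  rw [Measure.volume_eq_prod, Measure.prod_apply (isClosed_closedRegion hf hg a b).measurableSet]
  simp_rw [hsec]
  rw [lintegral_indicator measurableSet_Icc, intervalIntegral.integral_of_le hab,
    ← integral_Icc_eq_integral_Ioc, ofReal_integral_eq_lintegral_ofReal hi]
  exact (ae_restrict_iff' measurableSet_Icc).2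
    (Filter.Eventually.of_forall fun x hx => sub_nonneg.2 (hfg x hx))

lemma lin_add_int_mul_two_pi (φ : ℝ) (q : ℤ) (x : Plane) :
    lin (φ + q * (2 * Real.pi)) x = lin φ x :=
  (periodic_lin x).int_mul q φ

lemma volume_line_eq_zero {a b : ℝ} (h : a ≠ 0 ∨ b ≠ 0) :
    volume {x : Plane | x 0 * a + x 1 * b = 0} = 0 := by
  let f : Plane →ₗ[ℝ] ℝ :=
    { toFun := fun x => x 0 * a + x 1 * b
      map_add' := fun x y => by simp; ring
      map_smul' := fun c x => by simp; ring }
  have : {x : Plane | x 0 * a + x 1 * b = 0} = (LinearMap.ker f : Set Plane) := by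
    ext x; simp [f]
  rw [this]
  refine Measure.addHaar_submodule _ _ fun htop => ?_
  have h1 : (!₂[a, b] : Plane) ∈ LinearMap.ker f := by rw [htop]; trivial
  have h2 : a * a + b * b = 0 := by simpa [f] using h1
  rcases h with h | h
  · nlinarith [mul_self_pos.2 h, mul_self_nonneg b]
  · nlinarith [mul_self_pos.2 h, mul_self_nonneg a]

/-! ### Area of a circumscribed polygon by triangles -/

/-- The polygon with support numbers `h (iδ)`. -/
def polygon (h : ℝ → ℝ) (δ : ℝ) : Set Plane := {x | ∀ i : ℤ, lin (i * δ) x ≤ h (i * δ)}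

/-- The part of a polygon nearest, in its gauge, to the edge with normal angle `φ`. -/
def polygonSector (h : ℝ → ℝ) (δ φ : ℝ) : Set Plane :=
  {x ∈ polygon h δ | ∀ j : ℤ, lin (j * δ) x * h φ ≤ lin φ x * h (j * δ)}

section polygon

variable {h : ℝ → ℝ} {δ : ℝ} {N : ℕ}

lemma exists_reduce (hN0 : 0 < N) (m : ℤ) : ∃ k q : ℤ, m = k + 2 * N * q ∧ -N ≤ k ∧ k ≤ N := by
  have hpos : (0 : ℤ) < 2 * N := by positivity
  have h1 := Int.emod_add_mul_ediv m (2 * N)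
  have h2 := Int.emod_nonneg m hpos.ne'
  have h3 := Int.emod_lt_of_pos m hpos
  by_cases hk : m % (2 * N) ≤ N
  · exact ⟨m % (2 * N), m / (2 * N), h1.symm, by omega, hk⟩
  · refine ⟨m % (2 * N) - 2 * N, m / (2 * N) + 1, by linarith, by omega, by omega⟩

lemma angle_reduce (hN : N * δ = Real.pi) {j i k q : ℤ} (hj : j - i = k + 2 * N * q) :
    (j : ℝ) * δ = i * δ + k * δ + q * (2 * Real.pi) := by
  have : (j : ℝ) = i + k + 2 * N * q := by
    have : j = i + k + 2 * N * q := by linarith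
    exact_mod_cast this
  rw [this, ← hN]; ring

/-- The left side is the functional at angle `φ + kδ` on the vertex common to the edges `φ` and `φ +
δ`: that vertex obeys the other constraints up to half a turn. -/
lemma support_tangent_le (hh : AngleSublinear h) (hδ : δ ∈ Set.Ioc 0 (Real.pi / 2))
    (hN : N * δ = Real.pi) (φ : ℝ) {k : ℕ} (hk : k ≤ N) :
    Real.cos (k * δ) * h φ +
      Real.sin (k * δ) * ((h (φ + δ) - Real.cos δ * h φ) / Real.sin δ) ≤ h (φ + k * δ) := by
  have hs := sin_pos_of_mem hδ
  rcases Nat.eq_zero_or_pos k with rfl | hk0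
  · simp
  have h1 : (1 : ℝ) ≤ k := by exact_mod_cast hk0
  have h2 : (k : ℝ) ≤ N := by exact_mod_cast hk
  have key := hh φ (φ + δ) (φ + k * δ) (by linarith [hδ.1]) (by nlinarith [hδ.1])
    (by rw [← hN]; nlinarith [hδ.1])
  rw [add_sub_cancel_left, add_sub_cancel_left, show φ + k * δ - (φ + δ) = k * δ - δ by ring,
    Real.sin_sub] at key
  rw [mul_div_assoc', ← le_sub_iff_add_le', div_le_iff₀ hs]
  linarith

lemma support_tangent_le' (hh : AngleSublinear h) (hδ : δ ∈ Set.Ioc 0 (Real.pi / 2))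
    (hN : N * δ = Real.pi) (φ : ℝ) {k : ℕ} (hk : k ≤ N) :
    Real.cos (k * δ) * h φ -
      Real.sin (k * δ) * ((Real.cos δ * h φ - h (φ - δ)) / Real.sin δ) ≤ h (φ - k * δ) := by
  have hh' : AngleSublinear fun x => h (-x) := by
    intro a b c hab hbc hca
    have := hh (-c) (-b) (-a) (by linarith) (by linarith) (by linarith)
    rw [show -a - -c = c - a by ring, show -a - -b = b - a by ring,
      show -b - -c = c - b by ring] at this
    linarith
  have := support_tangent_le hh' hδ hN (-φ) hk
  simp only [neg_add, neg_neg, ← sub_eq_add_neg] at this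
  refine le_trans (le_of_eq ?_) this
  ring

/-- The sector is the triangle spanned by the origin and its edge. The neighbouring normals give the
two slanted sides and the opposite normal gives `0 ≤ lin (i * δ) x`; the remaining constraints
follow from `support_tangent_le` and its mirror image. -/
lemma mem_polygonSector_iff (hper : Function.Periodic h (2 * Real.pi)) (hh : AngleSublinear h)
    (hpos : ∀ φ, 0 < h φ) (hN0 : 0 < N) (hδ : δ ∈ Set.Ioc 0 (Real.pi / 2)) (hN : N * δ = Real.pi)
    (i : ℤ) (x : Plane) :
    x ∈ polygonSector h δ (i * δ) ↔ 0 ≤ lin (i * δ) x ∧ lin (i * δ) x ≤ h (i * δ) ∧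
      (Real.cos δ * h (i * δ) - h (i * δ - δ)) / Real.sin δ * lin (i * δ) x ≤
        h (i * δ) * lin (i * δ + Real.pi / 2) x ∧
      h (i * δ) * lin (i * δ + Real.pi / 2) x ≤
        (h (i * δ + δ) - Real.cos δ * h (i * δ)) / Real.sin δ * lin (i * δ) x := by
  have hs := sin_pos_of_mem hδ
  set φ : ℝ := i * δ with hφ
  have hp := hpos φ
  constructor
  · rintro ⟨hx, hj⟩
    have e1 := hj (i + 1)
    have e2 := hj (i - 1)
    have e3 := hj (i + N)
    push_cast at e1 e2 e3
    rw [add_mul, one_mul, ← hφ, lin_angle_add] at e1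
    rw [sub_mul, one_mul, ← hφ, sub_eq_add_neg, lin_angle_add, Real.cos_neg, Real.sin_neg] at e2
    rw [add_mul, hN, ← hφ, lin_add_pi] at e3
    refine ⟨?_, hx i, ?_, ?_⟩
    · have : 0 < h φ + h (φ + Real.pi) := add_pos hp (hpos _)
      refine nonneg_of_mul_nonneg_left ?_ this
      linarith
    · rw [div_mul_eq_mul_div, div_le_iff₀ hs, sub_eq_add_neg φ δ]
      linarith
    · rw [div_mul_eq_mul_div, le_div_iff₀ hs]
      linarith
  · rintro ⟨h0, h1, h2, h3⟩
    have key : ∀ j : ℤ, lin (j * δ) x * h φ ≤ lin φ x * h (j * δ) := by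
      intro j
      obtain ⟨k, q, hj, hk1, hk2⟩ := exists_reduce hN0 (j - i)
      rw [angle_reduce hN hj, ← hφ, (hper.int_mul q) (φ + k * δ),
        lin_add_int_mul_two_pi, lin_angle_add]
      rcases le_total 0 k with hk | hk
      · lift k to ℕ using hk
        have hkN : k ≤ N := by exact_mod_cast hk2
        have t := support_tangent_le hh hδ hN φ hkN
        have s : 0 ≤ Real.sin (k * δ) := by
          refine Real.sin_nonneg_of_nonneg_of_le_pi (mul_nonneg (Nat.cast_nonneg _) hδ.1.le) ?_
          rw [← hN]; exact mul_le_mul_of_nonneg_right (by exact_mod_cast hkN) hδ.1.le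
        have t1 := mul_le_mul_of_nonneg_left t h0
        have t2 := mul_le_mul_of_nonneg_left h3 s
        push_cast
        linarith
      · obtain ⟨m, rfl⟩ : ∃ m : ℕ, k = -m := ⟨k.natAbs, by omega⟩
        have hkN : m ≤ N := by omega
        have t := support_tangent_le' hh hδ hN φ hkN
        have s : 0 ≤ Real.sin (m * δ) := by
          refine Real.sin_nonneg_of_nonneg_of_le_pi (mul_nonneg (Nat.cast_nonneg _) hδ.1.le) ?_
          rw [← hN]; exact mul_le_mul_of_nonneg_right (by exact_mod_cast hkN) hδ.1.le
        have t1 := mul_le_mul_of_nonneg_left t h0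
        have t2 := mul_le_mul_of_nonneg_left h2 s
        push_cast
        rw [neg_mul, Real.cos_neg, Real.sin_neg, ← sub_eq_add_neg]
        linarith
    refine ⟨fun j => ?_, key⟩
    have a := key j
    have b := mul_le_mul_of_nonneg_right h1 (hpos (j * δ)).le
    refine le_of_mul_le_mul_right ?_ hp
    linarith

lemma volume_polygonSector (hper : Function.Periodic h (2 * Real.pi)) (hh : AngleSublinear h)
    (hpos : ∀ φ, 0 < h φ) (hN0 : 0 < N) (hδ : δ ∈ Set.Ioc 0 (Real.pi / 2)) (hN : N * δ = Real.pi)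
    (i : ℤ) :
    volume (polygonSector h δ (i * δ)) = ENNReal.ofReal (h (i * δ) * edge h δ (i * δ) / 2) := by
  set φ : ℝ := i * δ with hφ
  have hp := hpos φ
  set τ₁ := (Real.cos δ * h φ - h (φ - δ)) / Real.sin δ with hτ₁
  set τ₂ := (h (φ + δ) - Real.cos δ * h φ) / Real.sin δ with hτ₂
  have hτ : τ₂ - τ₁ = edge h δ φ := by rw [hτ₁, hτ₂, edge]; ring
  have hset : polygonSector h δ φ = {x : Plane | (lin φ x, lin (φ + Real.pi / 2) x) ∈
      closedRegion (fun ξ => τ₁ * ξ / h φ) (fun ξ => τ₂ * ξ / h φ) 0 (h φ)} := by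
    ext x
    rw [hφ, mem_polygonSector_iff hper hh hpos hN0 hδ hN i x, ← hφ]
    simp only [closedRegion, Set.mem_ofPred_eq, Set.mem_Icc, div_le_iff₀ hp, le_div_iff₀ hp,
      mul_comm (h φ) (lin (φ + Real.pi / 2) x), ← hτ₁, ← hτ₂]
    tauto
  have he := hh.edge_nonneg hδ φ
  rw [hset, volume_frame φ (isClosed_closedRegion (by fun_prop) (by fun_prop) _ _).measurableSet,
    volume_closedRegion (by fun_prop) (by fun_prop) hp.le]
  · congr 1
    have : ∀ ξ, τ₂ * ξ / h φ - τ₁ * ξ / h φ = edge h δ φ / h φ * ξ := by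
      intro ξ; rw [← hτ]; ring
    simp only [this]
    rw [intervalIntegral.integral_const_mul, integral_id]
    field_simp
    ring
  · intro ξ hξ
    rw [div_le_div_iff_of_pos_right hp]
    exact mul_le_mul_of_nonneg_right (by linarith) hξ.1

lemma isClosed_polygonSector (h : ℝ → ℝ) (δ φ : ℝ) : IsClosed (polygonSector h δ φ) := by
  have c := continuous_lin
  have : polygonSector h δ φ = (⋂ i : ℤ, {x | lin (i * δ) x ≤ h (i * δ)}) ∩
      ⋂ j : ℤ, {x | lin (j * δ) x * h φ ≤ lin φ x * h (j * δ)} := by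
    ext x; simp [polygonSector, polygon]
  rw [this]
  refine IsClosed.inter (isClosed_iInter fun i => isClosed_le (c _) continuous_const)
    (isClosed_iInter fun i => isClosed_le ((c _).mul_const _) ((c _).mul_const _))

/-- A point belongs to the sector for which `lin / h` is largest; by periodicity only `2N` normals
compete. -/
lemma polygon_eq_biUnion (hper : Function.Periodic h (2 * Real.pi)) (hpos : ∀ φ, 0 < h φ)
    (hN0 : 0 < N) (hN : N * δ = Real.pi) :
    polygon h δ = ⋃ i ∈ Finset.range (2 * N), polygonSector h δ ((i : ℕ) * δ) := by
  ext x
  simp only [Set.mem_iUnion, exists_prop]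
  constructor
  · intro hx
    obtain ⟨i, hi, hmax⟩ := Finset.exists_max_image (Finset.range (2 * N))
      (fun i : ℕ => lin (i * δ) x / h (i * δ)) ⟨0, by simp; omega⟩
    refine ⟨i, hi, hx, fun j => ?_⟩
    have hpos2 : (0 : ℤ) < 2 * N := by positivity
    have h1 := Int.emod_add_mul_ediv j (2 * N)
    obtain ⟨m, hm⟩ := Int.eq_ofNat_of_zero_le (Int.emod_nonneg j hpos2.ne')
    have hmN : m < 2 * N := by
      have := Int.emod_lt_of_pos j hpos2
      omega
    rw [hm] at h1
    have e : (j : ℝ) * δ = m * δ + (j / (2 * N) : ℤ) * (2 * Real.pi) := by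
      have : (j : ℝ) = m + 2 * N * (j / (2 * N) : ℤ) := by
        have h2 : j = (m : ℤ) + 2 * N * (j / (2 * N)) := h1.symm
        conv_lhs => rw [h2]
        push_cast; ring
      rw [this, ← hN]; ring
    rw [e, (hper.int_mul _) (m * δ), lin_add_int_mul_two_pi]
    have := hmax m (Finset.mem_range.2 hmN)
    rwa [div_le_div_iff₀ (hpos _) (hpos _)] at this
  · rintro ⟨i, -, hx, -⟩
    exact hx

/-- Where two sectors meet the two ratios `lin / h` agree, which is a linear equation. It is
nontrivial, since positive multiples of distinct unit normals differ. -/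
lemma aedisjoint_polygonSector (hpos : ∀ φ, 0 < h φ) (hδ : 0 < δ) (hN : N * δ = Real.pi) {i j : ℕ}
    (hi : i < 2 * N) (hj : j < 2 * N) (hij : i ≠ j) :
    volume (polygonSector h δ (i * δ) ∩ polygonSector h δ (j * δ)) = 0 := by
  set a := Real.cos (j * δ) * h (i * δ) - Real.cos (i * δ) * h (j * δ) with ha
  set b := Real.sin (j * δ) * h (i * δ) - Real.sin (i * δ) * h (j * δ) with hb
  refine measure_mono_null (t := {x : Plane | x 0 * a + x 1 * b = 0}) ?_ (volume_line_eq_zero ?_)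
  · rintro x ⟨⟨-, h1⟩, ⟨-, h2⟩⟩
    have e1 := h1 j
    have e2 := h2 i
    push_cast at e1 e2
    have : lin (j * δ) x * h (i * δ) = lin (i * δ) x * h (j * δ) := le_antisymm e1 e2
    simp only [lin] at this
    simp only [Set.mem_ofPred_eq, ha, hb]
    linarith
  · by_contra! hcon
    obtain ⟨ha0, hb0⟩ := hcon
    have p1 := hpos (i * δ)
    have p2 := hpos (j * δ)
    have s1 := Real.sin_sq_add_cos_sq (i * δ)
    have s2 := Real.sin_sq_add_cos_sq (j * δ)
    rw [ha, sub_eq_zero] at ha0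
    rw [hb, sub_eq_zero] at hb0
    have hsq : h (i * δ) ^ 2 = h (j * δ) ^ 2 := by
      have e1 : (Real.cos (j * δ) * h (i * δ)) ^ 2 = (Real.cos (i * δ) * h (j * δ)) ^ 2 := by rw [ha0]
      have e2 : (Real.sin (j * δ) * h (i * δ)) ^ 2 = (Real.sin (i * δ) * h (j * δ)) ^ 2 := by rw [hb0]
      linear_combination e1 + e2 - h (i * δ) ^ 2 * s2 + h (j * δ) ^ 2 * s1
    have heq : h (i * δ) = h (j * δ) := (pow_left_inj₀ p1.le p2.le two_ne_zero).1 hsq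
    rw [heq] at ha0 hb0
    have hc := mul_right_cancel₀ p2.ne' ha0
    have hs := mul_right_cancel₀ p2.ne' hb0
    have hcos : Real.cos (j * δ - i * δ) = 1 := by
      rw [Real.cos_sub, hc, hs]; linarith
    have hi' : (i : ℝ) + 1 ≤ 2 * N := by exact_mod_cast hi
    have hj' : (j : ℝ) + 1 ≤ 2 * N := by exact_mod_cast hj
    have hi0 : (0 : ℝ) ≤ i := Nat.cast_nonneg i
    have hj0 : (0 : ℝ) ≤ j := Nat.cast_nonneg j
    have := (Real.cos_eq_one_iff_of_lt_of_lt (by rw [← hN]; nlinarith) (by rw [← hN]; nlinarith)).1 hcos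
    rw [← sub_mul, mul_eq_zero, or_iff_left hδ.ne', sub_eq_zero] at this
    exact hij (by exact_mod_cast this.symm)

/-- The area of a polygon containing the origin in its interior. -/
theorem volume_polygon (hper : Function.Periodic h (2 * Real.pi)) (hh : AngleSublinear h)
    (hpos : ∀ φ, 0 < h φ) (hN0 : 0 < N) (hδ : δ ∈ Set.Ioc 0 (Real.pi / 2)) (hN : N * δ = Real.pi) :
    volume (polygon h δ) = ENNReal.ofReal (polyArea h δ N 0) := by
  rw [polygon_eq_biUnion hper hpos hN0 hN, measure_biUnion_finset₀]
  · have : ∀ i : ℕ, volume (polygonSector h δ (i * δ)) =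
        ENNReal.ofReal (h (i * δ) * edge h δ (i * δ) / 2) := fun i => by
      have := volume_polygonSector hper hh hpos hN0 hδ hN i
      simpa using this
    simp only [this]
    rw [← ENNReal.ofReal_sum_of_nonneg, polyArea, Finset.sum_div]
    · simp
    · intro i _
      have := hpos (i * δ)
      have := hh.edge_nonneg hδ (i * δ)
      positivity
  · intro i hi j hj hij
    simp only [Finset.coe_range, Set.mem_Iio] at hi hj
    exact aedisjoint_polygonSector hpos hδ.1 hN hi hj hij
  · exact fun i _ => (isClosed_polygonSector h δ _).measurableSet.nullMeasurableSet

end polygon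

/-! ### Circumscribed polygons converge in area -/

section convergence

variable {K : Set Plane}

lemma edge_sub_lin (h : ℝ → ℝ) (x : Plane) (δ φ : ℝ) :
    edge (fun ψ => h ψ - lin ψ x) δ φ = edge h δ φ := by
  unfold edge
  congr 1
  have : lin (φ + δ) x + lin (φ - δ) x = 2 * Real.cos δ * lin φ x := by
    simp only [lin, Real.cos_add, Real.cos_sub, Real.sin_add, Real.sin_sub]; ring
  linarith

lemma periodic_sub_lin {h : ℝ → ℝ} (hper : Function.Periodic h (2 * Real.pi)) (x : Plane) :
    Function.Periodic (fun ψ => h ψ - lin ψ x) (2 * Real.pi) :=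
  hper.sub (periodic_lin x)

/-- Translation invariance: the chain sums involve only the edges. -/
lemma polyArea_sub_lin {h : ℝ → ℝ} (hper : Function.Periodic h (2 * Real.pi)) {δ : ℝ} {N : ℕ}
    (hδ : Real.sin δ ≠ 0) (hN : N * δ = Real.pi) (x : Plane) (φ : ℝ) :
    polyArea (fun ψ => h ψ - lin ψ x) δ N φ = polyArea h δ N φ := by
  rw [polyArea_eq_chainSum hper hδ hN, polyArea_eq_chainSum (periodic_sub_lin hper x) hδ hN]
  simp only [edge_sub_lin]

lemma AngleSublinear.sub_lin {h : ℝ → ℝ} (hh : AngleSublinear h) (x : Plane) :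
    AngleSublinear fun ψ => h ψ - lin ψ x := by
  intro a b c hab hbc hca
  have := hh a b c hab hbc hca
  have e := sin_mul_lin a b c x
  simp only [sub_mul]
  linarith

/-- Translating an interior point `x` to the origin makes all support numbers positive. -/
lemma volume_polygon_of_pos_sub_lin {h : ℝ → ℝ} (hper : Function.Periodic h (2 * Real.pi))
    (hh : AngleSublinear h) {x : Plane} (hpos : ∀ φ, lin φ x < h φ) {δ : ℝ} {N : ℕ} (hN0 : 0 < N)
    (hδ : δ ∈ Set.Ioc 0 (Real.pi / 2)) (hN : N * δ = Real.pi) :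
    volume (polygon h δ) = ENNReal.ofReal (polyArea h δ N 0) := by
  rw [← polyArea_sub_lin hper (sin_pos_of_mem hδ).ne' hN x, ← volume_polygon
    (periodic_sub_lin hper x) (hh.sub_lin x) (fun φ => sub_pos.2 (hpos φ)) hN0 hδ hN,
    ← measure_preimage_add_right volume x]
  congr 1
  ext y
  simp [polygon, lin_add, le_sub_iff_add_le]

lemma polyArea_nonneg {h : ℝ → ℝ} (hper : Function.Periodic h (2 * Real.pi))
    (hh : AngleSublinear h) {x : Plane} (hpos : ∀ φ, lin φ x < h φ) {δ : ℝ} {N : ℕ}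
    (hδ : δ ∈ Set.Ioc 0 (Real.pi / 2)) (hN : N * δ = Real.pi) : 0 ≤ polyArea h δ N 0 := by
  rw [← polyArea_sub_lin hper (sin_pos_of_mem hδ).ne' hN x]
  refine div_nonneg (Finset.sum_nonneg fun i _ => mul_nonneg (sub_pos.2 (hpos _)).le ?_) two_pos.le
  exact (hh.sub_lin x).edge_nonneg hδ _

lemma subset_polygon (hK : IsCompact K) (δ : ℝ) : K ⊆ polygon (supp K) δ :=
  fun _ hx _ => lin_le_supp hK _ hx

lemma polygon_half_subset (h : ℝ → ℝ) (δ : ℝ) : polygon h (δ / 2) ⊆ polygon h δ := by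
  intro x hx i
  have := hx (2 * i)
  push_cast at this
  rwa [show 2 * (i : ℝ) * (δ / 2) = i * δ by ring] at this

/-- Powers of two make the sets of normals nested. -/
lemma antitone_polygon (h : ℝ → ℝ) : Antitone fun k : ℕ => polygon h (Real.pi / 2 ^ (k + 1)) := by
  refine antitone_nat_of_succ_le fun k => ?_
  rw [show Real.pi / 2 ^ (k + 1 + 1) = Real.pi / 2 ^ (k + 1) / 2 by rw [pow_succ _ (k + 1)]; field_simp]
  exact polygon_half_subset h _

lemma tendsto_pi_div_two_pow :
    Filter.Tendsto (fun k : ℕ => Real.pi / 2 ^ (k + 1)) Filter.atTop (nhds 0) :=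
  ((Filter.tendsto_add_atTop_iff_nat 1).2
    (tendsto_pow_atTop_atTop_of_one_lt one_lt_two)).const_div_atTop Real.pi

/-- A point outside `K` is outside a unit disc about some `a ∈ A`, and the direction `ψ` of `x - a`
separates it strictly from `K`. By continuity so does a nearby multiple of `π / 2 ^ (k + 1)`. -/
lemma iInter_polygon (hK : K ∈ ballBodies 2) (hc : IsCompact K) (hne : K.Nonempty) :
    ⋂ k : ℕ, polygon (supp K) (Real.pi / 2 ^ (k + 1)) = K := by
  refine subset_antisymm (fun x hx => ?_) (Set.subset_iInter fun k => subset_polygon hc _)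
  by_contra hxK
  obtain ⟨A, rfl⟩ := hK
  obtain ⟨a, ha, hxa⟩ : ∃ a ∈ A, 1 < dist x a := by simpa using hxK
  obtain ⟨ψ, hψ⟩ := exists_lin_eq_norm (x - a)
  rw [dist_eq_norm, ← hψ] at hxa
  have hsupp : ∀ φ, supp (⋂ x ∈ A, closedBall x 1) φ ≤ lin φ a + 1 := by
    intro φ
    obtain ⟨y, hy, hyφ⟩ := exists_lin_eq_supp hc hne φ
    have h1 := lin_le_norm φ (y - a)
    have h2 := Set.mem_iInter₂.1 hy a ha
    rw [mem_closedBall, dist_eq_norm] at h2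
    rw [lin_sub] at h1
    linarith
  have hlim : Filter.Tendsto (fun k : ℕ => (⌊ψ / (Real.pi / 2 ^ (k + 1))⌋ : ℝ) *
      (Real.pi / 2 ^ (k + 1))) Filter.atTop (nhds ψ) := by
    refine tendsto_of_tendsto_of_tendsto_of_le_of_le
      (by simpa using (tendsto_pi_div_two_pow.const_sub ψ)) tendsto_const_nhds ?_ ?_
    · intro k
      have hpos : 0 < Real.pi / 2 ^ (k + 1) := by positivity
      have := (Int.sub_one_lt_floor (ψ / (Real.pi / 2 ^ (k + 1)))).le
      rw [sub_le_iff_le_add, div_le_iff₀ hpos] at this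
      simp only
      linarith
    · intro k
      have hpos : 0 < Real.pi / 2 ^ (k + 1) := by positivity
      exact (le_div_iff₀ hpos).1 (Int.floor_le _)
  have hcont : Continuous fun φ => lin φ (x - a) := by unfold lin; fun_prop
  obtain ⟨k, hk⟩ := ((hcont.tendsto ψ).comp hlim |>.eventually (lt_mem_nhds hxa)).exists
  have h1 := Set.mem_iInter.1 hx k ⌊ψ / (Real.pi / 2 ^ (k + 1))⌋
  have h2 := hsupp ((⌊ψ / (Real.pi / 2 ^ (k + 1))⌋ : ℝ) * (Real.pi / 2 ^ (k + 1)))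
  simp only [Function.comp, lin_sub] at hk
  linarith

/-- The area of a ball-body with interior points is the limit of the areas of circumscribed
polygons. -/
theorem tendsto_polyArea (hK : K ∈ ballBodies 2) (hc : IsCompact K) {x : Plane} {ρ : ℝ} (hρ : 0 < ρ)
    (hx : closedBall x ρ ⊆ K) :
    Filter.Tendsto (fun k : ℕ => polyArea (supp K) (Real.pi / 2 ^ (k + 1)) (2 ^ (k + 1)) 0)
      Filter.atTop (nhds (area K)) := by
  have hpi := Real.pi_pos
  have hne : K.Nonempty := ⟨x, hx (mem_closedBall_self hρ.le)⟩
  have hper := periodic_supp K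
  have hh := angleSublinear_supp hc hne
  have hpos : ∀ φ, lin φ x < supp K φ := by
    intro φ
    have hmem : x + ρ • unitVec φ ∈ K := by
      refine hx ?_
      rw [mem_closedBall, dist_eq_norm, add_sub_cancel_left, norm_smul, norm_unitVec, mul_one,
        Real.norm_eq_abs, abs_of_pos hρ]
    have := lin_le_supp hc φ hmem
    rw [lin_add, lin_smul, lin_unitVec] at this
    linarith
  have hδm : ∀ k : ℕ, Real.pi / 2 ^ (k + 1) ∈ Set.Ioc 0 (Real.pi / 2) := fun k => by
    refine ⟨by positivity, div_le_div_of_nonneg_left hpi.le two_pos ?_⟩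
    exact le_self_pow₀ one_le_two (by omega)
  have hN : ∀ k : ℕ, ((2 ^ (k + 1) : ℕ) : ℝ) * (Real.pi / 2 ^ (k + 1)) = Real.pi := fun k => by
    push_cast; field_simp
  have hvol := fun k : ℕ => volume_polygon_of_pos_sub_lin hper hh hpos (N := 2 ^ (k + 1))
    (by positivity) (hδm k) (hN k)
  have hlim := tendsto_measure_iInter_atTop (μ := volume)
    (s := fun k : ℕ => polygon (supp K) (Real.pi / 2 ^ (k + 1))) (fun k => by
      have : polygon (supp K) (Real.pi / 2 ^ (k + 1)) =
          ⋂ i : ℤ, {x | lin (i * (Real.pi / 2 ^ (k + 1))) x ≤ supp K (i * (Real.pi / 2 ^ (k + 1)))} := by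
        ext y; simp [polygon]
      rw [this]
      exact (isClosed_iInter fun i => isClosed_le (continuous_lin _)
        continuous_const).measurableSet.nullMeasurableSet)
    (antitone_polygon _) ⟨0, by rw [hvol]; exact ENNReal.ofReal_ne_top⟩
  rw [iInter_polygon hK hc hne] at hlim
  have hfin : volume K ≠ ⊤ := hc.measure_lt_top.ne
  have := (ENNReal.tendsto_toReal hfin).comp hlim
  refine this.congr fun k => ?_
  simp only [Function.comp, hvol]
  exact ENNReal.toReal_ofReal (polyArea_nonneg hper hh hpos (hδm k) (hN k))

end convergence

/-! ### The two inequalities for ball-bodies -/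

lemma exists_closedBall_subset {n : ℕ} {K : Set (EuclideanSpace ℝ (Fin n))} (hK : K ∈ ballBodies n)
    (hnt : K.Nontrivial) : ∃ x, ∃ ρ > 0, closedBall x ρ ⊆ K := by
  obtain ⟨y, hy, z, hz, hyz⟩ := hnt
  refine ⟨_, _, ?_, closedBall_subset_of_mem_ballBodies hK hy hz (t := 1 / 2) (by norm_num)⟩
  have : 0 < ‖z - y‖ := norm_pos_iff.2 (sub_ne_zero.2 hyz.symm)
  positivity

lemma area_closedBall (x : Plane) {r : ℝ} (hr : 0 ≤ r) : area (closedBall x r) = r ^ 2 * Real.pi := by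
  rw [area, EuclideanSpace.volume_closedBall_fin_two, ENNReal.toReal_mul, ENNReal.toReal_pow,
    ENNReal.toReal_ofReal hr, ENNReal.toReal_ofReal Real.pi_pos.le]

lemma cDual_singleton {n : ℕ} (x : EuclideanSpace ℝ (Fin n)) : cDual {x} = closedBall x 1 := by
  simp [cDual]

lemma sqrt_area_singleton (x : Plane) :
    √(area {x}) + √(area (cDual {x})) = √Real.pi := by
  rw [cDual_singleton, area_closedBall x zero_le_one]
  simp [area]

lemma sqrt_two_pi_sub_four_le : √(2 * Real.pi - 4) ≤ √Real.pi :=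
  Real.sqrt_le_sqrt (by linarith [Real.pi_le_four])

/-- The bounds for the sum of the square roots of the areas of a planar ball-body and its dual. -/
theorem sqrt_area_bounds {K : Set Plane} (hK : K ∈ ballBodies 2) (h0 : K ≠ ∅) (h1 : K ≠ Set.univ) :
    √(2 * Real.pi - 4) ≤ √(area K) + √(area (cDual K)) ∧
      √(area K) + √(area (cDual K)) ≤ √Real.pi := by
  have hne : K.Nonempty := Set.nonempty_iff_ne_empty.2 h0
  have hne' := cDual_nonempty hK h1
  have hK' := cDual_mem_ballBodies K
  -- A point has no interior, as the polygon argument requires; it is dual to a unit disc and the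
  -- sum is then exactly `√π`.
  rcases K.subsingleton_or_nontrivial with hs | hnt
  · obtain ⟨x, rfl⟩ := hs.eq_empty_or_singleton.resolve_left h0
    rw [sqrt_area_singleton]
    exact ⟨sqrt_two_pi_sub_four_le, le_rfl⟩
  rcases (cDual K).subsingleton_or_nontrivial with hs | hnt'
  · obtain ⟨x, hx⟩ := hs.eq_empty_or_singleton.resolve_left hne'.ne_empty
    have : K = cDual {x} := by rw [← hx, cDual_cDual hK]
    rw [hx, this, add_comm, sqrt_area_singleton]
    exact ⟨sqrt_two_pi_sub_four_le, le_rfl⟩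
  have hc := isCompact_of_cDual_nonempty hK hne'
  have hc' := isCompact_of_cDual_nonempty hK' (by rwa [cDual_cDual hK])
  obtain ⟨x, ρ, hρ, hx⟩ := exists_closedBall_subset hK hnt
  obtain ⟨x', ρ', hρ', hx'⟩ := exists_closedBall_subset hK' hnt'
  have hdual : supp (cDual K) = fun φ => 1 - supp K (φ + Real.pi) :=
    funext (supp_cDual hK hne hne')
  have hb := tendsto_polyArea hK' hc' hρ' hx'
  have e' := fun δ hδ => (angleSublinear_supp hc' hne').edge_nonneg (δ := δ) hδ
  rw [hdual] at hb e'
  refine sqrt_area_bounds_of_tendsto (periodic_supp K)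
    (fun δ hδ => (angleSublinear_supp hc hne).edge_nonneg hδ) (fun δ hδ φ => ?_)
    (tendsto_polyArea hK hc hρ hx) hb
  -- The upper bound for the edges of `K` is the nonnegativity of the opposite edges of the dual.
  have := e' δ hδ (φ - Real.pi)
  rw [edge_dual, sub_add_cancel] at this
  linarith

/-! ### Lenses -/

/-- The point with coordinates `ξ`, `τ` in the frame with origin `m` and directions `φ`,
`φ + π / 2`. -/
noncomputable def framePoint (m : Plane) (φ ξ τ : ℝ) : Plane :=
  m + ξ • unitVec φ + τ • unitVec (φ + Real.pi / 2)

lemma dist_framePoint_sq (m : Plane) (φ ξ τ ξ' τ' : ℝ) :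
    dist (framePoint m φ ξ τ) (framePoint m φ ξ' τ') ^ 2 = (ξ - ξ') ^ 2 + (τ - τ') ^ 2 := by
  rw [plane_dist_sq]
  simp only [framePoint, unitVec, Real.cos_add_pi_div_two, Real.sin_add_pi_div_two,
    PiLp.add_apply, PiLp.smul_apply, smul_eq_mul, Matrix.cons_val_zero, Matrix.cons_val_one,
    Matrix.cons_val_fin_one]
  linear_combination ((ξ - ξ') ^ 2 + (τ - τ') ^ 2) * Real.sin_sq_add_cos_sq φ

lemma framePoint_surjective (m : Plane) (φ : ℝ) (x : Plane) : ∃ ξ τ, x = framePoint m φ ξ τ := by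
  refine ⟨lin φ (x - m), lin (φ + Real.pi / 2) (x - m), ?_⟩
  have h := Real.sin_sq_add_cos_sq φ
  ext i
  fin_cases i
  · simp [framePoint, unitVec, lin, Real.cos_add_pi_div_two, Real.sin_add_pi_div_two]
    linear_combination (m 0 - x 0) * h
  · simp [framePoint, unitVec, lin, Real.cos_add_pi_div_two, Real.sin_add_pi_div_two]
    linear_combination (m 1 - x 1) * h

lemma framePoint_rotate (m : Plane) (φ ξ τ : ℝ) :
    framePoint m (φ + Real.pi / 2) ξ τ = framePoint m φ (-τ) ξ := by
  ext i
  fin_cases i <;>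
  · simp [framePoint, unitVec, Real.cos_add_pi_div_two, Real.sin_add_pi_div_two]
    ring

lemma dist_le_one_iff {x y : Plane} : dist x y ≤ 1 ↔ dist x y ^ 2 ≤ 1 := by
  rw [sq_le_one_iff₀ dist_nonneg]

/-- The lens with midpoint `m`, axis direction `φ` and centres at distance `c` from `m`. -/
noncomputable def lens (m : Plane) (φ c : ℝ) : Set Plane :=
  closedBall (framePoint m φ (-c) 0) 1 ∩ closedBall (framePoint m φ c 0) 1

/-- Only the centre on the far side of the point matters; it is `|ξ| + c` away along the axis. -/
lemma mem_lens {m : Plane} {φ c ξ τ : ℝ} (hc : 0 ≤ c) :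
    framePoint m φ ξ τ ∈ lens m φ c ↔ (|ξ| + c) ^ 2 + τ ^ 2 ≤ 1 := by
  simp only [lens, Set.mem_inter_iff, mem_closedBall, dist_le_one_iff, dist_framePoint_sq]
  rcases abs_cases ξ with ⟨h, h'⟩ | ⟨h, h'⟩ <;> rw [h] <;> constructor
  · rintro ⟨h1, h2⟩; linarith
  · intro h1
    have := mul_nonneg hc h'
    constructor <;> linarith
  · rintro ⟨h1, h2⟩; linarith
  · intro h1
    have := mul_nonneg hc (neg_nonneg.2 h'.le)
    constructor <;> linarith

section lens

variable {m : Plane} {φ c s : ℝ}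

lemma corner_mem_lens (hc : 0 ≤ c) (hcs : c ^ 2 + s ^ 2 = 1) : framePoint m φ 0 s ∈ lens m φ c := by
  rw [mem_lens hc]; simp [hcs]

/-- The dual of a lens is the lens centred at its corners. -/
theorem cDual_lens (hc : 0 ≤ c) (hs : 0 ≤ s) (hcs : c ^ 2 + s ^ 2 = 1) :
    cDual (lens m φ c) = lens m (φ + Real.pi / 2) s := by
  ext x
  constructor
  · intro hx
    have h1 := mem_cDual.1 hx _ (corner_mem_lens hc hcs)
    have h2 := mem_cDual.1 hx _ (corner_mem_lens (s := -s) hc (by rw [neg_sq]; exact hcs))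
    simp only [lens, framePoint_rotate, neg_zero]
    exact ⟨h2, h1⟩
  · intro hx
    obtain ⟨ξ, τ, rfl⟩ := framePoint_surjective m φ x
    have e : framePoint m φ ξ τ = framePoint m (φ + Real.pi / 2) τ (-ξ) := by
      rw [framePoint_rotate, neg_neg]
    rw [e, mem_lens hs, neg_sq] at hx
    rw [mem_cDual]
    intro y hy
    obtain ⟨ξ', τ', rfl⟩ := framePoint_surjective m φ y
    rw [mem_lens hc] at hy
    rw [dist_le_one_iff, dist_framePoint_sq]
    have hξ : |ξ| ≤ c := by
      refine le_of_sq_le_sq ?_ hc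
      nlinarith [abs_nonneg τ, sq_abs ξ, mul_nonneg (abs_nonneg τ) hs, sq_nonneg |τ|]
    have hτ : |τ'| ≤ s := by
      refine le_of_sq_le_sq ?_ hs
      nlinarith [abs_nonneg ξ', sq_abs τ', mul_nonneg (abs_nonneg ξ') hc, sq_nonneg |ξ'|]
    -- Adding the two membership inequalities and using `c² + s² = 1` leaves `2 c |ξ'| + 2 s |τ|` to
    -- spare. This pays for the cross terms, because `|ξ| ≤ c` and `|τ'| ≤ s`.
    have p1 := mul_nonneg (abs_nonneg ξ') (sub_nonneg.2 hξ)
    have p2 := mul_nonneg (abs_nonneg τ) (sub_nonneg.2 hτ)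
    have q1 : -(ξ * ξ') ≤ |ξ| * |ξ'| := by rw [← abs_mul]; exact neg_le_abs _
    have q2 : -(τ * τ') ≤ |τ| * |τ'| := by rw [← abs_mul]; exact neg_le_abs _
    have r1 := sq_abs ξ'
    have r2 := sq_abs τ
    linarith

lemma diam_lens (hc : 0 ≤ c) (hs : 0 ≤ s) (hcs : c ^ 2 + s ^ 2 = 1) : diam (lens m φ c) = 2 * s := by
  have hsub : lens m φ c ⊆ closedBall m s := by
    intro x hx
    obtain ⟨ξ, τ, rfl⟩ := framePoint_surjective m φ x
    rw [mem_lens hc] at hx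
    have e : dist (framePoint m φ ξ τ) m ^ 2 = ξ ^ 2 + τ ^ 2 := by
      have := dist_framePoint_sq m φ ξ τ 0 0
      simpa [framePoint] using this
    refine le_of_sq_le_sq ?_ hs
    rw [e]
    have := mul_nonneg (abs_nonneg ξ) hc
    nlinarith [sq_abs ξ]
  apply le_antisymm
  · exact (diam_mono hsub isBounded_closedBall).trans (diam_closedBall hs)
  · have h1 := dist_le_diam_of_mem (isBounded_closedBall.subset hsub)
      (corner_mem_lens (m := m) (φ := φ) hc hcs)
      (corner_mem_lens (s := -s) hc (by rw [neg_sq]; exact hcs))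
    refine le_trans (le_of_sq_le_sq ?_ dist_nonneg) h1
    rw [dist_framePoint_sq]
    linarith

lemma exists_eq_framePoint (p q : Plane) : ∃ m φ, p = framePoint m φ (-(dist p q / 2)) 0 ∧
    q = framePoint m φ (dist p q / 2) 0 := by
  obtain ⟨φ, hφ⟩ := exists_lin_eq_norm (q - p)
  have hnorm : ‖q - p‖ = dist p q := by rw [dist_comm, dist_eq_norm]
  have horth : lin (φ + Real.pi / 2) (q - p) = 0 := by
    have h := lin_sq_add_sq φ (q - p)
    rw [← plane_norm_sq, hφ] at h
    exact pow_eq_zero_iff two_ne_zero |>.1 (by linarith)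
  have hqp : q - p = dist p q • unitVec φ := by
    have hs := Real.sin_sq_add_cos_sq φ
    simp only [lin, Real.cos_add_pi_div_two, Real.sin_add_pi_div_two] at horth
    rw [lin] at hφ
    rw [hnorm] at hφ
    rw [← hφ]
    ext i
    fin_cases i
    · simp [unitVec] at horth ⊢
      linear_combination -Real.sin φ * horth - (q 0 - p 0) * hs
    · simp [unitVec] at horth ⊢
      linear_combination Real.cos φ * horth - (q 1 - p 1) * hs
  refine ⟨p + (dist p q / 2) • unitVec φ, φ, ?_, ?_⟩
  · simp [framePoint]
  · have : q = p + dist p q • unitVec φ := by rw [← hqp]; abel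
    simp only [framePoint, zero_smul, add_zero]
    conv_lhs => rw [this]
    module

lemma exists_eq_lens {L : Set Plane} (hL : IsLens L) :
    ∃ m φ c s, 0 ≤ c ∧ 0 ≤ s ∧ c ^ 2 + s ^ 2 = 1 ∧ L = lens m φ c := by
  obtain ⟨⟨x, hx⟩, p, q, rfl⟩ := hL
  have hd : dist p q ≤ 2 := by
    have h1 := mem_closedBall'.1 hx.1
    have h2 := mem_closedBall.1 hx.2
    linarith [dist_triangle p x q]
  obtain ⟨m, φ, hp, hq⟩ := exists_eq_framePoint p q
  have hc0 : 0 ≤ dist p q / 2 := by positivity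
  have hc1 : (dist p q / 2) ^ 2 ≤ 1 := pow_le_one₀ hc0 (by linarith)
  refine ⟨m, φ, dist p q / 2, √(1 - (dist p q / 2) ^ 2), hc0, Real.sqrt_nonneg _, ?_, ?_⟩
  · rw [Real.sq_sqrt (by linarith)]; ring
  · rw [lens, ← hp, ← hq]

lemma integral_sqrt_one_sub_sq_zero_one : ∫ x in (0:ℝ)..1, √(1 - x ^ 2) = Real.pi / 4 := by
  have hc : Continuous fun x : ℝ => √(1 - x ^ 2) := by fun_prop
  have h1 := intervalIntegral.integral_add_adjacent_intervals
    (hc.intervalIntegrable (μ := volume) (-1) 0) (hc.intervalIntegrable (μ := volume) 0 1)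
  have h2 := intervalIntegral.integral_comp_neg (a := -1) (b := 0) fun x : ℝ => √(1 - x ^ 2)
  simp only [neg_sq, neg_zero, neg_neg] at h2
  rw [integral_sqrt_one_sub_sq] at h1
  linarith

/-- The area of a lens with centres at distance `√2`. -/
theorem area_lens {p q : Plane} (h : dist p q = √2) :
    area (closedBall p 1 ∩ closedBall q 1) = Real.pi / 2 - 1 := by
  obtain ⟨φ, hφ⟩ := exists_lin_eq_norm (q - p)
  have hnorm : ‖q - p‖ = √2 := by rw [← dist_eq_norm, dist_comm, h]
  rw [hnorm] at hφ
  have h2 : √2 * √2 = 2 := Real.mul_self_sqrt two_pos.le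
  have horth : lin (φ + Real.pi / 2) (q - p) = 0 := by
    have h := lin_sq_add_sq φ (q - p)
    rw [← plane_norm_sq, hφ, hnorm] at h
    exact pow_eq_zero_iff two_ne_zero |>.1 (by linarith)
  -- In the frame turned by `-π / 4` from the axis, `q - p` is `(1, 1)` and the lens is the region
  -- over `[0, 1]` between two quarter circles.
  set ψ := φ + -(Real.pi / 4) with hψ
  have hψ1 : lin ψ (q - p) = 1 := by
    rw [hψ, lin_angle_add, hφ, horth, Real.cos_neg, Real.cos_pi_div_four]
    linarith
  have hψ2 : lin (ψ + Real.pi / 2) (q - p) = 1 := by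
    rw [hψ, show φ + -(Real.pi / 4) + Real.pi / 2 = φ + Real.pi / 4 by ring, lin_angle_add, hφ, horth,
      Real.cos_pi_div_four]
    linarith
  set S := closedRegion (fun x => 1 - √(1 - (x - 1) ^ 2)) (fun x => √(1 - x ^ 2)) 0 1 with hS
  have hset : (fun x => x + p) ⁻¹' (closedBall p 1 ∩ closedBall q 1) =
      {x : Plane | (lin ψ x, lin (ψ + Real.pi / 2) x) ∈ S} := by
    ext x
    have d1 : dist (x + p) p ^ 2 = lin ψ x ^ 2 + lin (ψ + Real.pi / 2) x ^ 2 := by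
      rw [dist_eq_norm, plane_norm_sq, ← lin_sq_add_sq ψ, add_sub_cancel_right]
    have d2 : dist (x + p) q ^ 2 = (lin ψ x - 1) ^ 2 + (lin (ψ + Real.pi / 2) x - 1) ^ 2 := by
      rw [dist_eq_norm, plane_norm_sq, ← lin_sq_add_sq ψ, show x + p - q = x - (q - p) by abel,
        lin_sub ψ x (q - p), lin_sub _ x (q - p), hψ1, hψ2]
    simp only [Set.mem_preimage, Set.mem_inter_iff, mem_closedBall, dist_le_one_iff, d1, d2, hS,
      closedRegion, Set.mem_ofPred_eq, Set.mem_Icc]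
    generalize lin ψ x = X
    generalize lin (ψ + Real.pi / 2) x = Y
    constructor
    · rintro ⟨h1, h2⟩
      refine ⟨⟨?_, ?_⟩, ?_, Real.le_sqrt_of_sq_le (by linarith)⟩
      · nlinarith [sq_nonneg (Y - 1)]
      · nlinarith [sq_nonneg Y]
      · have : 1 - Y ≤ √(1 - (X - 1) ^ 2) := Real.le_sqrt_of_sq_le (by nlinarith)
        linarith
    · rintro ⟨⟨hX0, hX1⟩, h1, h2⟩
      have a1 : 0 ≤ 1 - X ^ 2 := by nlinarith
      have a2 : 0 ≤ 1 - (X - 1) ^ 2 := by nlinarith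
      have b1 := Real.sq_sqrt a1
      have b2 := Real.sq_sqrt a2
      have c1 := Real.sqrt_nonneg (1 - X ^ 2)
      have c2 := Real.sqrt_nonneg (1 - (X - 1) ^ 2)
      have e1 : √(1 - X ^ 2) ≤ 1 := Real.sqrt_le_one.2 (by nlinarith)
      have e2 : √(1 - (X - 1) ^ 2) ≤ 1 := Real.sqrt_le_one.2 (by nlinarith)
      constructor <;> nlinarith
  have hle : ∀ x ∈ Set.Icc (0:ℝ) 1, 1 - √(1 - (x - 1) ^ 2) ≤ √(1 - x ^ 2) := by
    intro x hx
    have a1 : 1 - x ≤ √(1 - x ^ 2) := Real.le_sqrt_of_sq_le (by nlinarith [hx.1, hx.2])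
    have a2 : x ≤ √(1 - (x - 1) ^ 2) := Real.le_sqrt_of_sq_le (by nlinarith [hx.1, hx.2])
    linarith
  have hint : ∫ x in (0:ℝ)..1, (√(1 - x ^ 2) - (1 - √(1 - (x - 1) ^ 2))) = Real.pi / 2 - 1 := by
    have e := intervalIntegral.integral_comp_sub_left (a := 0) (b := 1) (fun x : ℝ => √(1 - x ^ 2)) 1
    have e' : ∀ x : ℝ, √(1 - (x - 1) ^ 2) = √(1 - (1 - x) ^ 2) := fun x => by ring_nf
    simp only [e']
    rw [intervalIntegral.integral_sub (Continuous.intervalIntegrable (by fun_prop) _ _)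
      (Continuous.intervalIntegrable (by fun_prop) _ _),
      intervalIntegral.integral_sub (Continuous.intervalIntegrable (by fun_prop) _ _)
      (Continuous.intervalIntegrable (by fun_prop) _ _), e, sub_self, sub_zero,
      integral_sqrt_one_sub_sq_zero_one]
    simp; ring
  rw [area, ← measure_preimage_add_right volume p, hset,
    volume_frame ψ (isClosed_closedRegion (by fun_prop) (by fun_prop) _ _).measurableSet,
    volume_closedRegion (by fun_prop) (by fun_prop) zero_le_one hle, hint,
    ENNReal.toReal_ofReal (by linarith [Real.two_le_pi])]

lemma dist_centers_lens (m : Plane) (φ c : ℝ) (hc : 0 ≤ c) :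
    dist (framePoint m φ (-c) 0) (framePoint m φ c 0) = 2 * c := by
  rw [← sq_eq_sq₀ dist_nonneg (by positivity), dist_framePoint_sq]; ring

/-- A quarter turn about the midpoint exchanges the lenses with orthogonal axes. -/
lemma exists_isometry_lens (m : Plane) (φ c : ℝ) :
    ∃ g : Plane ≃ᵢ Plane, g '' lens m φ c = lens m (φ + Real.pi / 2) c := by
  -- `frame (-π / 2)` is the quarter turn `x ↦ (-x 1, x 0)`.
  let g : Plane ≃ᵢ Plane := ((IsometryEquiv.addRight (-m)).trans
    (frame (-(Real.pi / 2))).toIsometryEquiv).trans (IsometryEquiv.addRight m)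
  have hg : ∀ ξ, g (framePoint m φ ξ 0) = framePoint m (φ + Real.pi / 2) ξ 0 := by
    intro ξ
    have : g (framePoint m φ ξ 0) = frame (-(Real.pi / 2)) (framePoint m φ ξ 0 + -m) + m := rfl
    rw [this, frame_apply]
    ext i
    fin_cases i <;>
      simp [framePoint, unitVec, lin, Real.cos_add_pi_div_two, Real.sin_add_pi_div_two, add_comm]
  refine ⟨g, ?_⟩
  rw [lens, Set.image_inter g.injective, g.image_closedBall, g.image_closedBall, hg, hg, lens]

/-- An isometry preserves the diameter, which is `2s` for the lens and `2c` for its dual. -/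
lemma isSelfDual_lens_iff (hc : 0 ≤ c) (hs : 0 ≤ s) (hcs : c ^ 2 + s ^ 2 = 1) :
    IsSelfDual (lens m φ c) ↔ c = s := by
  unfold IsSelfDual
  rw [cDual_lens hc hs hcs]
  constructor
  · rintro ⟨g, hg⟩
    have := g.isometry.diam_image (lens m φ c)
    rw [hg, diam_lens hc hs hcs, diam_lens hs hc (by rw [add_comm]; exact hcs)] at this
    linarith
  · rintro rfl
    exact exists_isometry_lens m φ c

lemma two_mul_eq_sqrt_two_iff (hc : 0 ≤ c) (hs : 0 ≤ s) (hcs : c ^ 2 + s ^ 2 = 1) :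
    2 * s = √2 ↔ c = s := by
  have h2 : √2 ^ 2 = 2 := Real.sq_sqrt two_pos.le
  constructor
  · intro h
    rw [← sq_eq_sq₀ hc hs]
    have : (2 * s) ^ 2 = 2 := by rw [h, h2]
    linarith
  · rintro rfl
    rw [← sq_eq_sq₀ (by positivity) (Real.sqrt_nonneg _), h2]
    linarith

theorem isSelfDual_iff_diam {L : Set Plane} (hL : IsLens L) : IsSelfDual L ↔ diam L = √2 := by
  obtain ⟨m, φ, c, s, hc, hs, hcs, rfl⟩ := exists_eq_lens hL
  rw [isSelfDual_lens_iff hc hs hcs, diam_lens hc hs hcs, two_mul_eq_sqrt_two_iff hc hs hcs]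

/-- Pythagoras: a centre and the two corners form a triangle with unit legs and third side `diam L`.
-/
theorem hasLensAngle_iff_diam {L : Set Plane} (hL : IsLens L) :
    HasLensAngle L (Real.pi / 2) ↔ diam L = √2 := by
  constructor
  · rintro ⟨p, q, a, b, -, ha, hb, hab, hp, -⟩
    rw [← EuclideanGeometry.dist_sq_eq_dist_sq_add_dist_sq_iff_angle_eq_pi_div_two,
      mem_sphere.1 ha.1, mem_sphere.1 hb.1, hab] at hp
    rw [eq_comm, Real.sqrt_eq_iff_mul_self_eq two_pos.le diam_nonneg]
    linarith
  · obtain ⟨m, φ, c, s, hc, hs, hcs, rfl⟩ := exists_eq_lens hL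
    rw [diam_lens hc hs hcs, two_mul_eq_sqrt_two_iff hc hs hcs]
    rintro rfl
    have hd : ∀ x y : Plane, dist x y ^ 2 = 1 → dist x y = 1 := fun x y h =>
      (pow_eq_one_iff_of_nonneg dist_nonneg two_ne_zero).1 h
    have h1 : dist (framePoint m φ 0 c) (framePoint m φ (-c) 0) = 1 :=
      hd _ _ (by rw [dist_framePoint_sq]; linarith)
    have h2 : dist (framePoint m φ 0 c) (framePoint m φ c 0) = 1 :=
      hd _ _ (by rw [dist_framePoint_sq]; linarith)
    have h3 : dist (framePoint m φ 0 (-c)) (framePoint m φ (-c) 0) = 1 :=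
      hd _ _ (by rw [dist_framePoint_sq]; linarith)
    have h4 : dist (framePoint m φ 0 (-c)) (framePoint m φ c 0) = 1 :=
      hd _ _ (by rw [dist_framePoint_sq]; linarith)
    have h5 : dist (framePoint m φ 0 c) (framePoint m φ 0 (-c)) = 2 * c := by
      rw [← sq_eq_sq₀ dist_nonneg (by positivity), dist_framePoint_sq]; ring
    refine ⟨_, _, framePoint m φ 0 c, framePoint m φ 0 (-c), rfl, ⟨h1, h2⟩, ⟨h3, h4⟩, ?_, ?_, ?_⟩
    · rw [h5, diam_lens hc hc hcs]
    · rw [← EuclideanGeometry.dist_sq_eq_dist_sq_add_dist_sq_iff_angle_eq_pi_div_two, h1, h3, h5]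
      linarith
    · rw [← EuclideanGeometry.dist_sq_eq_dist_sq_add_dist_sq_iff_angle_eq_pi_div_two, h2, h4, h5]
      linarith

theorem sqrt_area_of_isSelfDual {L : Set Plane} (hL : IsLens L) (h : IsSelfDual L) :
    √(area L) + √(area (cDual L)) = √(2 * Real.pi - 4) := by
  obtain ⟨m, φ, c, s, hc, hs, hcs, rfl⟩ := exists_eq_lens hL
  obtain rfl := (isSelfDual_lens_iff hc hs hcs).1 h
  have h2 := (two_mul_eq_sqrt_two_iff hc hc hcs).2 rfl
  rw [cDual_lens hc hc hcs, lens, lens, area_lens ((dist_centers_lens m φ c hc).trans h2),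
    area_lens ((dist_centers_lens m _ c hc).trans h2),
    show 2 * Real.pi - 4 = 2 ^ 2 * (Real.pi / 2 - 1) by ring, Real.sqrt_mul (by positivity),
    Real.sqrt_sq two_pos.le, two_mul]

lemma mem_ballBodies_of_isLens {n : ℕ} {L : Set (EuclideanSpace ℝ (Fin n))} (hL : IsLens L) :
    L ∈ ballBodies n := by
  obtain ⟨-, p, q, rfl⟩ := hL
  exact ⟨{p, q}, by simp⟩

lemma ne_univ_of_subset_closedBall {L : Set Plane} {x : Plane} {r : ℝ} (h : L ⊆ closedBall x r) :
    L ≠ Set.univ := by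
  rintro rfl
  exact NormedSpace.unbounded_univ ℝ Plane (isBounded_closedBall.subset h)

lemma exists_isSelfDual_lens : ∃ L : Set Plane, IsLens L ∧ IsSelfDual L := by
  have hc : (0 : ℝ) ≤ √2 / 2 := by positivity
  have hcs : (√2 / 2) ^ 2 + (√2 / 2) ^ 2 = 1 := by
    rw [div_pow, Real.sq_sqrt two_pos.le]; norm_num
  exact ⟨lens 0 0 (√2 / 2), ⟨⟨_, corner_mem_lens hc hcs⟩, _, _, rfl⟩,
    (isSelfDual_lens_iff hc hc hcs).2 rfl⟩

end lens

/-! ### Discs of radius one half -/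

/-- The point of the disc farthest from `y` lies opposite to `y`, at distance `dist y x + 1 / 2`. -/
lemma cDual_closedBall_half (x : Plane) : cDual (closedBall x (1 / 2)) = closedBall x (1 / 2) := by
  ext y
  rw [mem_cDual]
  constructor
  · intro h
    obtain ⟨φ, hφ⟩ := exists_lin_eq_norm (y - x)
    have hmem : x - (1 / 2 : ℝ) • unitVec φ ∈ closedBall x (1 / 2) := by
      rw [mem_closedBall, dist_eq_norm, sub_sub_cancel_left, norm_neg, norm_smul, norm_unitVec]
      norm_num
    have h1 := h _ hmem
    have h2 := lin_le_norm φ (y - (x - (1 / 2 : ℝ) • unitVec φ))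
    rw [dist_eq_norm] at h1
    rw [lin_sub, lin_sub, lin_smul, lin_unitVec] at h2
    rw [mem_closedBall, dist_eq_norm, ← hφ, lin_sub]
    linarith
  · intro h a ha
    have := dist_triangle_right y a x
    rw [mem_closedBall] at h ha
    linarith

end BallBody

theorem mainTheorem12 :
    -- the two inequalities
    (∀ K ∈ BallBody.ballBodies 2, K ≠ ∅ → K ≠ Set.univ →
      √(2 * Real.pi - 4) ≤ √(BallBody.area K) + √(BallBody.area (BallBody.cDual K)) ∧
      √(BallBody.area K) + √(BallBody.area (BallBody.cDual K)) ≤ √Real.pi) ∧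
    -- self-dual lenses exist, they are the lenses of diameter `√2`, equivalently of angle `π / 2`,
    -- and they give equality on the left
    (∃ L : Set (EuclideanSpace ℝ (Fin 2)), BallBody.IsLens L ∧ BallBody.IsSelfDual L) ∧
    (∀ L : Set (EuclideanSpace ℝ (Fin 2)), BallBody.IsLens L →
      (BallBody.IsSelfDual L ↔ Metric.diam L = √2) ∧
      (BallBody.IsSelfDual L ↔ BallBody.HasLensAngle L (Real.pi / 2)) ∧
      (BallBody.IsSelfDual L →
        L ∈ BallBody.ballBodies 2 ∧ L ≠ ∅ ∧ L ≠ Set.univ ∧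
        √(BallBody.area L) + √(BallBody.area (BallBody.cDual L)) = √(2 * Real.pi - 4))) ∧
    -- discs of radius `1 / 2` give equality on the right
    (∀ x : EuclideanSpace ℝ (Fin 2),
      Metric.closedBall x (1 / 2) ∈ BallBody.ballBodies 2 ∧
      Metric.closedBall x (1 / 2) ≠ ∅ ∧ Metric.closedBall x (1 / 2) ≠ Set.univ ∧
      √(BallBody.area (Metric.closedBall x (1 / 2))) +
        √(BallBody.area (BallBody.cDual (Metric.closedBall x (1 / 2)))) = √Real.pi) := by
  refine ⟨fun K hK h0 h1 => BallBody.sqrt_area_bounds hK h0 h1, BallBody.exists_isSelfDual_lens,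
    fun L hL => ⟨BallBody.isSelfDual_iff_diam hL, ?_, fun h => ?_⟩, fun x => ?_⟩
  · rw [BallBody.isSelfDual_iff_diam hL, BallBody.hasLensAngle_iff_diam hL]
  · refine ⟨BallBody.mem_ballBodies_of_isLens hL, hL.1.ne_empty, ?_,
      BallBody.sqrt_area_of_isSelfDual hL h⟩
    obtain ⟨-, p, q, rfl⟩ := hL
    exact BallBody.ne_univ_of_subset_closedBall Set.inter_subset_left
  · refine ⟨?_, (nonempty_closedBall.2 (by norm_num)).ne_empty,
      BallBody.ne_univ_of_subset_closedBall subset_rfl, ?_⟩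
    · rw [← BallBody.cDual_closedBall_half x]
      exact BallBody.cDual_mem_ballBodies _
    · rw [BallBody.cDual_closedBall_half, BallBody.area_closedBall x (by norm_num),
        Real.sqrt_mul (by positivity), Real.sqrt_sq (by norm_num)]
      ring
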